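/- **Theorem 4 (Liveness of RADON-C).** *System.* There are a set of readers, a totally ordered set $\mathcal W$ of writers (together: clients) and $n$ servers, which are asynchronous processes: each keeps taking its enabled local steps, at arbitrary speed, until it fails. Links are reliable: a message eventually reaches its destination as long as the destination does not fail. Clients may fail (permanently) at any point. A server is *active*, *crashed* or in *repair*; a crash event takes it from active or repair to crashed, it then loses all its data and every message that reaches it while it is crashed, and an external repair event takes it from crashed to repair. A client invokes an operation only when all its previous operations are complete (well-formedness). A *group-send* of $[m_1,\dots,m_n]$ consists of $n$ successive point-to-point sends of $m_i$ to server $i$; the sender may fail in between. Responses are matched to the group-send they answer. *Algorithm.* Let $1\le k\le n$, $\delta\in\mathbb N$, and let $\Phi=(\Phi_1,\dots,\Phi_n)$ be the (stripe-wise) encoder of an $[n,k]$ linear MDS code over a finite field, so that any $k$ coded elements determine the value. Tags are pairs $(z,w)\in\mathbb N\times\mathcal W$ in lexicographic order. Server $i$ holds a finite set $List$ of (tag, coded element) pairs, initially $\{(t_0,\Phi_i(v_0))\}$. Only active servers answer. On a tag query a server returns its highest tag; on a list query (of a reader or of a repairing server) it returns $List$; on $(t,c)$ it adds $(t,c)$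 to $List$, keeps only the pairs of the $\delta+1$ highest tags if there are more than $\delta+1$ pairs, and returns an ack. - *write*$(v)$ by $w$: group-send a tag query, await responses from a majority of the servers, let $t^*$ be the highest tag received; then group-send $(t_w,\Phi_i(v))_{i}$ with $t_w=(t^*.z+1,w)$, and terminate after $\lceil\frac{3n+k}{4}\rceil$ acks. The tag of this write is $t_w$. - *read*: group-send a list query, await $\lceil\frac{n+k}{2}\rceil$ lists, select the highest tag $t_r$ for which some value $v_r$ is decodable from these lists, i.e. for which $k$ of the lists contain the tag $t_r$ with the coded elements of $v_r$ (the read is stuck if there is none); then group-send $(t_r,\Phi_i(v_r))_i$, await $\lceil\frac{3n+k}{4}\rceil$ acks and return $v_r$. - *repair* of server $i$ (started by a repair event): group-send a list query, await $\lceil\frac{n+k}{2}\rceil$ lists, set $List$ to the pairs $(t,\Phi_i(v))$ for the at most $\delta+1$ highest tags $t$ that are decodable, with value $v$, from these lists, and become active. *Network stability condition $N1$ with parameter $\alpha\in(0,1)$.* For every group-send that is not cut short by a failure of its sender there is a set of $\lceil\alpha n\rceil$ servers that all receive and process their messages, and that are all active throughout $[T_1,T_2]$, where $T_1$ is the time of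 invocation of the group-send and $T_2$ the earliest time at which all of them have processed their messages. *Concurrency.* A read is *valid* if its reader stays alive until it has received the $\lceil\frac{n+k}{2}\rceil$ lists, and then $T_2$ denotes the time at which it has received them; a repair is *valid* if the server does not crash during it, and then $T_2$ denotes the time at which it completes. The number of writes concurrent with a valid read or repair $\pi$ is the number of writes that start before $T_2$ and whose tag is higher than the tags of all writes that complete before $\pi$ starts. *Claim.* Let $\beta$ be a well-formed execution of RADON-C that satisfies $N1$ with $\frac{3n+k}{4n}\le\alpha<1$ and in which at most $\delta$ writes are concurrent with any valid read or repair. Then every read and every write operation invoked in $\beta$ by a non-faulty client completes. In particular, whenever a read has received its $\lceil\frac{n+k}{2}\rceil$ lists, $k$ of them contain a common tag with the coded elements of one value. -/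

import Mathlib

namespace Radon

universe u v w

noncomputable section

open scoped Classical

/-! ## Values, tags and erasure coding -/

/-- Tags: pairs (integer, writer), ordered by the integer first and then by the writer. -/
abbrev Tag (W : Type u) := ℕ ×ₗ W

/-- A value is divided into `k` elements, each of them a block of `l` field symbols
(one symbol per stripe). -/
abbrev Value (k l : ℕ) (F : Type w) := Fin k → Fin l → F

/-- A coded element has the size of one of the `k` elements of a value. -/
abbrev Coded (l : ℕ) (F : Type w) := Fin l → F

/-- `encode G v i` is the coded element of server `i` for the value `v`: every stripe is encoded
with the generator matrix `G` (row `i` of `G` produces the symbol of server `i`). -/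
def encode {n k l : ℕ} {F : Type w} [Field F] (G : Matrix (Fin n) (Fin k) F)
    (v : Value k l F) (i : Fin n) : Coded l F :=
  fun s => ∑ j, G i j * v j s

/-- The linear code generated by `G` is an `[n, k]` MDS code: any `k` of the `n` code symbols
determine the message. -/
def IsMDS {n k : ℕ} {F : Type w} [Field F] (G : Matrix (Fin n) (Fin k) F) : Prop :=
  ∀ S : Finset (Fin n), S.card = k →
    ∀ x y : Fin k → F, (∀ i ∈ S, G.mulVec x i = G.mulVec y i) → x = y

/-- The static data of an instance of the algorithm. -/
structure System (n k l : ℕ) (W : Type u) (F : Type w) where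
  /-- the concurrency parameter: servers keep up to `delta + 1` versions -/
  delta : ℕ
  /-- the generator matrix of the code -/
  gen : Matrix (Fin n) (Fin k) F
  /-- the initial tag -/
  t0 : Tag W
  /-- the initial value -/
  v0 : Value k l F

/-- The content of the variable `List` of a server: a finite set of (tag, coded element) pairs. -/
abbrev VList (l : ℕ) (W : Type u) (F : Type w) := Finset (Tag W × Coded l F)

/-- If there are more than `d + 1` pairs, retain the pairs for the `d + 1` highest tags. -/
def prune {l : ℕ} {W : Type u} {F : Type w} [LinearOrder W] (d : ℕ) (L : VList l W F) :
    VList l W F :=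
  if d + 1 < L.card then
    L.filter fun p => ((L.image Prod.fst).filter fun t => p.1 < t).card < d + 1
  else L

/-- The highest tag of a list (`t0` if the list is empty). -/
def maxTag {l : ℕ} {W : Type u} {F : Type w} [LinearOrder W] (t0 : Tag W) (L : VList l W F) :
    Tag W :=
  (L.image Prod.fst).max.unbotD t0

/-! ## Messages and group-sends -/

/-- Processes. -/
inductive Proc (n : ℕ) (W : Type u) (R : Type v) where
  | writer (i : W)
  | reader (i : R)
  | server (i : Fin n)

/-- Bodies of the messages that are sent to the servers by group-sends. -/
inductive Req (l : ℕ) (W : Type u) (F : Type w) where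
  | queryTag
  | codeElem (t : Tag W) (c : Coded l F)
  | queryList
  | repairList

/-- Bodies of the responses of the servers. -/
inductive Resp (l : ℕ) (W : Type u) (F : Type w) where
  | tag (t : Tag W)
  | list (L : VList l W F)
  | ack

/-- A message of the group-send `id` on its way from process `src` to server `dst`. -/
structure ReqMsg (n l : ℕ) (W : Type u) (R : Type v) (F : Type w) where
  id : ℕ
  src : Proc n W R
  dst : Fin n
  body : Req l W F

/-- A response, to a message of the group-send `id`, on its way from server `src` to `dst`. -/
structure RespMsg (n l : ℕ) (W : Type u) (R : Type v) (F : Type w) where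
  id : ℕ
  src : Fin n
  dst : Proc n W R
  body : Resp l W F

/-- A group-send in progress at some process, together with the collection of `need` responses
to it that the process awaits. -/
structure Call (n l : ℕ) (W : Type u) (F : Type w) where
  /-- identifier of the group-send -/
  id : ℕ
  /-- the message for each server -/
  msg : Fin n → Req l W F
  /-- the servers to which the message has not been sent yet -/
  unsent : Finset (Fin n)
  /-- the number of responses that are awaited -/
  need : ℕ
  /-- the responses received so far -/
  got : Fin n → Option (Resp l W F)

namespace Call

variable {n l : ℕ} {W : Type u} {R : Type v} {F : Type w}

/-- Invocation of a group-send. -/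
def start (id : ℕ) (need : ℕ) (msg : Fin n → Req l W F) : Call n l W F :=
  ⟨id, msg, Finset.univ, need, fun _ => none⟩

/-- Number of responses received. -/
def count (c : Call n l W F) : ℕ :=
  (Finset.univ.filter fun i => (c.got i).isSome).card

/-- All messages have been sent and the awaited number of responses has been received. -/
def Complete (c : Call n l W F) : Prop :=
  c.unsent = ∅ ∧ c.count = c.need

/-- Reception of a response. Responses to other group-sends, and responses in excess of the awaited
number, are ignored. -/
def accept (m : RespMsg n l W R F) (c : Call n l W F) : Call n l W F :=
  if m.id = c.id ∧ c.count < c.need then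
    { c with got := Function.update c.got m.src (some m.body) }
  else c

/-- The message for server `i` has been sent. -/
def markSent (i : Fin n) (c : Call n l W F) : Call n l W F :=
  { c with unsent := c.unsent.erase i }

end Call

/-- The value `v` can be decoded for the tag `t` from the received lists: there are `k` lists
that contain the tag `t`, with coded elements that decode to `v`. -/
def Decodable {n k l : ℕ} {W : Type u} {F : Type w} [Field F] (G : Matrix (Fin n) (Fin k) F)
    (got : Fin n → Option (Resp l W F)) (t : Tag W) (v : Value k l F) : Prop :=
  ∃ S : Finset (Fin n), S.card = k ∧
    ∀ i ∈ S, ∃ L : VList l W F, got i = some (Resp.list L) ∧ (t, encode G v i) ∈ L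

/-! ## Configurations -/

/-- Local state of a writer; `op` is the identifier of the operation in progress. -/
inductive WriterState (n k l : ℕ) (W : Type u) (F : Type w) where
  | idle
  | getTag (op : ℕ) (v : Value k l F) (c : Call n l W F)
  | putData (op : ℕ) (t : Tag W) (v : Value k l F) (c : Call n l W F)
  | failed

/-- Local state of a reader. -/
inductive ReaderState (n k l : ℕ) (W : Type u) (F : Type w) where
  | idle
  | getData (op : ℕ) (c : Call n l W F)
  | putData (op : ℕ) (t : Tag W) (v : Value k l F) (c : Call n l W F)
  | failed

/-- Local state of a server. A crashed server has lost all its data; the list of a server in the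
repair state is not used until it is restored. -/
inductive ServerState (n l : ℕ) (W : Type u) (F : Type w) where
  | active (L : VList l W F)
  | crashed
  | repair (op : ℕ) (c : Call n l W F)

/-- Global configurations: local states, messages in transit, and the next unused identifier
(identifiers name operations and group-sends; an operation bears the identifier of its first
group-send). -/
structure Config (n k l : ℕ) (W : Type u) (R : Type v) (F : Type w) where
  writer : W → WriterState n k l W F
  reader : R → ReaderState n k l W F
  server : Fin n → ServerState n l W F
  reqs : Set (ReqMsg n l W R F)
  resps : Set (RespMsg n l W R F)
  fresh : ℕ

section

variable {n k l : ℕ} {W : Type u} {R : Type v} {F : Type w}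

/-- The group-send in progress of a writer. -/
def WriterState.call? : WriterState n k l W F → Option (Call n l W F)
  | .idle => none
  | .getTag _ _ c => some c
  | .putData _ _ _ c => some c
  | .failed => none

/-- Modify the group-send in progress of a writer. -/
def WriterState.mapCall (f : Call n l W F → Call n l W F) :
    WriterState n k l W F → WriterState n k l W F
  | .idle => .idle
  | .getTag op v c => .getTag op v (f c)
  | .putData op t v c => .putData op t v (f c)
  | .failed => .failed

/-- The group-send in progress of a reader. -/
def ReaderState.call? : ReaderState n k l W F → Option (Call n l W F)
  | .idle => none
  | .getData _ c => some c
  | .putData _ _ _ c => some c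
  | .failed => none

/-- Modify the group-send in progress of a reader. -/
def ReaderState.mapCall (f : Call n l W F → Call n l W F) :
    ReaderState n k l W F → ReaderState n k l W F
  | .idle => .idle
  | .getData op c => .getData op (f c)
  | .putData op t v c => .putData op t v (f c)
  | .failed => .failed

/-- The group-send in progress of a server. -/
def ServerState.call? : ServerState n l W F → Option (Call n l W F)
  | .active _ => none
  | .crashed => none
  | .repair _ c => some c

/-- Modify the group-send in progress of a server. -/
def ServerState.mapCall (f : Call n l W F → Call n l W F) :
    ServerState n l W F → ServerState n l W F
  | .active L => .active L
  | .crashed => .crashed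
  | .repair op c => .repair op (f c)

/-- The server is in the active state. -/
def ServerState.IsActive (s : ServerState n l W F) : Prop :=
  ∃ L, s = .active L

namespace Config

/-- The group-send in progress of a process. -/
def call? (c : Config n k l W R F) : Proc n W R → Option (Call n l W F)
  | .writer i => (c.writer i).call?
  | .reader i => (c.reader i).call?
  | .server i => (c.server i).call?

/-- Change the local state of a writer. -/
def setWriter (c : Config n k l W R F) (i : W) (s : WriterState n k l W F) :
    Config n k l W R F :=
  { c with writer := Function.update c.writer i s }

/-- Change the local state of a reader. -/
def setReader (c : Config n k l W R F) (i : R) (s : ReaderState n k l W F) :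
    Config n k l W R F :=
  { c with reader := Function.update c.reader i s }

/-- Change the local state of a server. -/
def setServer (c : Config n k l W R F) (i : Fin n) (s : ServerState n l W F) :
    Config n k l W R F :=
  { c with server := Function.update c.server i s }

/-- Modify the group-send in progress of a process. -/
def mapCall (c : Config n k l W R F) (f : Call n l W F → Call n l W F) :
    Proc n W R → Config n k l W R F
  | .writer i => c.setWriter i ((c.writer i).mapCall f)
  | .reader i => c.setReader i ((c.reader i).mapCall f)
  | .server i => c.setServer i ((c.server i).mapCall f)

/-- The identifier `c.fresh` has been used. -/
def tick (c : Config n k l W R F) : Config n k l W R F :=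
  { c with fresh := c.fresh + 1 }

/-- The process is a failed client or a crashed server. -/
def Down (c : Config n k l W R F) : Proc n W R → Prop
  | .writer i => c.writer i = .failed
  | .reader i => c.reader i = .failed
  | .server i => c.server i = .crashed

/-- The initial configuration. -/
def init [Field F] (P : System n k l W F) : Config n k l W R F where
  writer := fun _ => .idle
  reader := fun _ => .idle
  server := fun i => .active {(P.t0, encode P.gen P.v0 i)}
  reqs := ∅
  resps := ∅
  fresh := 0

end Config

end

/-! ## The algorithm -/

/-- Events of an execution. -/
inductive Event (n k l : ℕ) (W : Type u) (R : Type v) (F : Type w) where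
  /-- nothing happens -/
  | stutter
  /-- invocation step of a write operation; its get-tag phase begins -/
  | invokeWrite (i : W) (op : ℕ) (v : Value k l F)
  /-- the write operation chooses its tag `t`; its put-data phase begins -/
  | writePut (i : W) (op : ℕ) (t : Tag W) (id : ℕ)
  /-- response step of a write operation -/
  | writeDone (i : W) (op : ℕ)
  /-- invocation step of a read operation; its get-data phase begins -/
  | invokeRead (i : R) (op : ℕ)
  /-- the read operation decodes a value; its put-data phase begins -/
  | readPut (i : R) (op : ℕ) (t : Tag W) (v : Value k l F) (id : ℕ)
  /-- response step of a read operation, which returns `v` -/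
  | readDone (i : R) (op : ℕ) (v : Value k l F)
  /-- crash event at a server -/
  | crash (i : Fin n)
  /-- repair event at a crashed server: a repair operation begins -/
  | repairStart (i : Fin n) (op : ℕ)
  /-- a repair operation completes -/
  | repairDone (i : Fin n) (op : ℕ)
  /-- failure of a writer -/
  | failWriter (i : W)
  /-- failure of a reader -/
  | failReader (i : R)
  /-- process `p` sends the message for server `i` of the group-send `id` -/
  | send (p : Proc n W R) (i : Fin n) (id : ℕ)
  /-- a message reaches a server -/
  | recvReq (m : ReqMsg n l W R F)
  /-- a response reaches its destination -/
  | recvResp (m : RespMsg n l W R F)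

/-- The process that invokes a group-send in this event, and the identifier of the group-send. -/
def Event.groupSend? {n k l : ℕ} {W : Type u} {R : Type v} {F : Type w} :
    Event n k l W R F → Option (Proc n W R × ℕ)
  | .invokeWrite i op _ => some (.writer i, op)
  | .writePut i _ _ id => some (.writer i, id)
  | .invokeRead i op => some (.reader i, op)
  | .readPut i _ _ _ id => some (.reader i, id)
  | .repairStart i op => some (.server i, op)
  | _ => none

/-- The process that takes a step of its own program in this event. (Invocations, failures, crash
and repair events are triggered externally; receptions are controlled by the network.) -/
def Event.local? {n k l : ℕ} {W : Type u} {R : Type v} {F : Type w} :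
    Event n k l W R F → Option (Proc n W R)
  | .writePut i _ _ _ => some (.writer i)
  | .writeDone i _ => some (.writer i)
  | .readPut i _ _ _ _ => some (.reader i)
  | .readDone i _ _ => some (.reader i)
  | .repairDone i _ => some (.server i)
  | .send p _ _ => some p
  | _ => none

section

variable {n k l : ℕ} {W : Type u} {R : Type v} {F : Type w} [LinearOrder W] [Field F]

/-- What an active server with the list `L` does with a message: its new list and its response. -/
def serve (P : System n k l W F) (L : VList l W F) : Req l W F → VList l W F × Resp l W F
  | .queryTag => (L, .tag (maxTag P.t0 L))
  | .codeElem t c => (prune P.delta (insert (t, c) L), .ack)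
  | .queryList => (L, .list L)
  | .repairList => (L, .list L)

/-- The messages of a put-data phase. -/
def codeElems (P : System n k l W F) (t : Tag W) (v : Value k l F) (i : Fin n) : Req l W F :=
  .codeElem t (encode P.gen v i)

/-- The steps of the algorithm. -/
inductive Step (P : System n k l W F) :
    Config n k l W R F → Event n k l W R F → Config n k l W R F → Prop where
  | stutter (c) : Step P c .stutter c
  /-- A writer invokes an operation only if it has none in progress (well-formedness). -/
  | invokeWrite (c : Config n k l W R F) (i : W) (v : Value k l F)
      (h : c.writer i = .idle) :
      Step P c (.invokeWrite i c.fresh v)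
        (c.setWriter i (.getTag c.fresh v
          (Call.start c.fresh (n / 2 + 1) fun _ => .queryTag))).tick
  | writePut (c : Config n k l W R F) (i : W) (op : ℕ) (v : Value k l F) (a : Call n l W F)
      (t : Tag W) (h : c.writer i = .getTag op v a) (ha : a.Complete)
      (ht : ∃ s, a.got s = some (.tag t))
      (hmax : ∀ s t', a.got s = some (.tag t') → t' ≤ t) :
      Step P c (.writePut i op (toLex ((ofLex t).1 + 1, i)) c.fresh)
        (c.setWriter i (.putData op (toLex ((ofLex t).1 + 1, i)) v
          (Call.start c.fresh ((3 * n + k) ⌈/⌉ 4)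
            (codeElems P (toLex ((ofLex t).1 + 1, i)) v)))).tick
  | writeDone (c : Config n k l W R F) (i : W) (op : ℕ) (t : Tag W) (v : Value k l F)
      (a : Call n l W F) (h : c.writer i = .putData op t v a) (ha : a.Complete) :
      Step P c (.writeDone i op) (c.setWriter i .idle)
  /-- A reader invokes an operation only if it has none in progress (well-formedness). -/
  | invokeRead (c : Config n k l W R F) (i : R) (h : c.reader i = .idle) :
      Step P c (.invokeRead i c.fresh)
        (c.setReader i (.getData c.fresh
          (Call.start c.fresh ((n + k) ⌈/⌉ 2) fun _ => .queryList))).tick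
  | readPut (c : Config n k l W R F) (i : R) (op : ℕ) (a : Call n l W F)
      (t : Tag W) (v : Value k l F) (h : c.reader i = .getData op a) (ha : a.Complete)
      (hdec : Decodable P.gen a.got t v)
      (hmax : ∀ t' v', Decodable P.gen a.got t' v' → t' ≤ t) :
      Step P c (.readPut i op t v c.fresh)
        (c.setReader i (.putData op t v
          (Call.start c.fresh ((3 * n + k) ⌈/⌉ 4) (codeElems P t v)))).tick
  | readDone (c : Config n k l W R F) (i : R) (op : ℕ) (t : Tag W) (v : Value k l F)
      (a : Call n l W F) (h : c.reader i = .putData op t v a) (ha : a.Complete) :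
      Step P c (.readDone i op v) (c.setReader i .idle)
  | crash (c : Config n k l W R F) (i : Fin n) (h : c.server i ≠ .crashed) :
      Step P c (.crash i) (c.setServer i .crashed)
  | repairStart (c : Config n k l W R F) (i : Fin n) (h : c.server i = .crashed) :
      Step P c (.repairStart i c.fresh)
        (c.setServer i (.repair c.fresh
          (Call.start c.fresh ((n + k) ⌈/⌉ 2) fun _ => .repairList))).tick
  /-- `D` is the set of all decodable (tag, value) pairs, re-encoded for server `i`. It may be
  empty: a repair operation does not get stuck. -/
  | repairDone (c : Config n k l W R F) (i : Fin n) (op : ℕ) (a : Call n l W F)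
      (D : VList l W F) (h : c.server i = .repair op a) (ha : a.Complete)
      (hD : ∀ t x, (t, x) ∈ D ↔ ∃ v, Decodable P.gen a.got t v ∧ x = encode P.gen v i) :
      Step P c (.repairDone i op) (c.setServer i (.active (prune P.delta D)))
  | failWriter (c : Config n k l W R F) (i : W) (h : c.writer i ≠ .failed) :
      Step P c (.failWriter i) (c.setWriter i .failed)
  | failReader (c : Config n k l W R F) (i : R) (h : c.reader i ≠ .failed) :
      Step P c (.failReader i) (c.setReader i .failed)
  /-- A group-send consists of `n` point-to-point sends; the sender may fail between them. -/
  | send (c : Config n k l W R F) (p : Proc n W R) (a : Call n l W F) (i : Fin n)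
      (h : c.call? p = some a) (hi : i ∈ a.unsent) :
      Step P c (.send p i a.id)
        { c.mapCall (Call.markSent i) p with reqs := insert ⟨a.id, p, i, a.msg i⟩ c.reqs }
  /-- An active server consumes a message and responds. -/
  | recvReq (c : Config n k l W R F) (m : ReqMsg n l W R F) (L : VList l W F)
      (hm : m ∈ c.reqs) (h : c.server m.dst = .active L) :
      Step P c (.recvReq m)
        { c.setServer m.dst (.active (serve P L m.body).1) with
          reqs := c.reqs \ {m}
          resps := insert ⟨m.id, m.dst, m.src, (serve P L m.body).2⟩ c.resps }
  /-- A message that reaches a server that is not active has no effect. -/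
  | loseReq (c : Config n k l W R F) (m : ReqMsg n l W R F)
      (hm : m ∈ c.reqs) (h : ¬ (c.server m.dst).IsActive) :
      Step P c (.recvReq m) { c with reqs := c.reqs \ {m} }
  /-- A response that reaches a process without a group-send in progress (in particular a failed
  client or a crashed server) has no effect. -/
  | recvResp (c : Config n k l W R F) (m : RespMsg n l W R F) (hm : m ∈ c.resps) :
      Step P c (.recvResp m)
        { c.mapCall (Call.accept m) m.dst with resps := c.resps \ {m} }

/-- Well-formed executions, as infinite sequences of configurations and events: event `τ` leads
from configuration `τ` to configuration `τ + 1`. Finite executions end in stuttering. -/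
structure Execution (R : Type v) (P : System n k l W F) where
  cfg : ℕ → Config n k l W R F
  ev : ℕ → Event n k l W R F
  start : cfg 0 = Config.init P
  step : ∀ τ, Step P (cfg τ) (ev τ) (cfg (τ + 1))

namespace Execution

variable {P : System n k l W F} (β : Execution R P)

/-! ## Asynchronous processes and reliable links -/

/-- No process that can take a step of its own program is denied one forever. -/
def ProcessesProgress : Prop :=
  ∀ (p : Proc n W R) (τ : ℕ), ∃ τ' ≥ τ,
    (β.ev τ').local? = some p ∨
      ¬ ∃ e c', Step P (β.cfg τ') e c' ∧ e.local? = some p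

/-- As long as its destination does not fail, every message eventually reaches it. -/
def ReliableLinks : Prop :=
  (∀ τ, ∀ m ∈ (β.cfg τ).reqs, ∃ τ' ≥ τ,
    β.ev τ' = .recvReq m ∨ (β.cfg τ').Down (.server m.dst)) ∧
  (∀ τ, ∀ m ∈ (β.cfg τ).resps, ∃ τ' ≥ τ,
    β.ev τ' = .recvResp m ∨ (β.cfg τ').Down m.dst)

/-- The process never fails (crashes). -/
def NonFaulty (p : Proc n W R) : Prop :=
  ∀ τ, ¬ (β.cfg τ).Down p

/-! ## Network stability -/

/-- Network stability condition `N1` with parameter `α`: for every group-send that is executed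
completely (all `n` messages are sent), invoked in event `T₁`, there are `⌈α n⌉` servers that all
consume their messages by some time `T₂` and that are all active throughout `[T₁, T₂]`. -/
def N1 (α : ℝ) : Prop :=
  ∀ (p : Proc n W R) (id T₁ : ℕ), (β.ev T₁).groupSend? = some (p, id) →
    (∀ i : Fin n, ∃ τ, β.ev τ = .send p i id) →
    ∃ (S : Finset (Fin n)) (T₂ : ℕ), S.card = ⌈α * n⌉₊ ∧ T₁ ≤ T₂ ∧
      (∀ i ∈ S, ∃ τ < T₂, ∃ m, β.ev τ = .recvReq m ∧ m.id = id ∧ m.dst = i) ∧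
      (∀ i ∈ S, ∀ T, T₁ ≤ T → T ≤ T₂ → ((β.cfg T).server i).IsActive)

/-! ## Concurrent writes -/

/-- `t` is the tag of the write operation `op`, which it uses in its put-data phase. -/
def HasTag (op : ℕ) (t : Tag W) : Prop :=
  ∃ τ i id, β.ev τ = .writePut i op t id

/-- The write operation `op` is invoked before time `T`. -/
def WriteStartsBefore (op T : ℕ) : Prop :=
  ∃ τ < T, ∃ i v, β.ev τ = .invokeWrite i op v

/-- The write operation `op` completes before time `T`. -/
def WriteCompletesBefore (op T : ℕ) : Prop :=
  ∃ τ < T, ∃ i, β.ev τ = .writeDone i op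

/-- The write operations that start before `T₂` and whose tag exceeds the maximal tag of the
write operations that complete before `T₁`. -/
def concurrentWrites (T₁ T₂ : ℕ) : Set ℕ :=
  {op | β.WriteStartsBefore op T₂ ∧ ∃ t, β.HasTag op t ∧
    ∀ op' t', β.WriteCompletesBefore op' T₁ → β.HasTag op' t' → t' < t}

/-- At time `T`, the read operation `op` of the reader `r` is in its get-data phase and has
received all awaited responses, by the call `a`. -/
def HasLists (r : R) (op : ℕ) (a : Call n l W F) (T : ℕ) : Prop :=
  (β.cfg T).reader r = .getData op a ∧ a.count = a.need

/-- At most `d` writes are concurrent with any valid read operation (the reader stays alive until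
it has received the awaited responses of the get-data phase, first at time `T₂`) and with any
valid repair operation (the server does not crash before the repair completes, in event `T₂`). -/
def ConcurrencyAtMost (d : ℕ) : Prop :=
  (∀ (r : R) (op T₁ T₂ : ℕ), β.ev T₁ = .invokeRead r op →
    IsLeast {T | ∃ a, β.HasLists r op a T} T₂ →
    (β.concurrentWrites T₁ T₂).encard ≤ d) ∧
  (∀ (i : Fin n) (op T₁ T₂ : ℕ), β.ev T₁ = .repairStart i op →
    β.ev T₂ = .repairDone i op →
    (β.concurrentWrites T₁ T₂).encard ≤ d)

end Execution

end

end

end Radon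

/-! The numbers are chosen for two intersections. Two sets of `⌈(3n+k)/4⌉` servers share at least
`⌈(n+k)/2⌉`, and two sets of `⌈(n+k)/2⌉` servers share at least `k`.

Safety of a version. Consider a read between its invocation `T₁` and the first time `T₂` at which it
has its lists, and let `t` be the highest tag of a write completed before `T₁`. Let `G` consist of
the servers that acknowledged this write and also belong to the set given by `N1`; it has
`⌈(n+k)/2⌉` elements (`written_quorum`). Each server of `G` stays active from the moment it stores
the version until a time `B` by which all of `G` have stored it. Up to `T₂` the version is never
lost at an active server of `G` (`version_persists`). Pruning cannot remove it: any tag above `t`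
present in the system was chosen by a write concurrent with the read (`list_tag_known`,
`card_known_le`), so there are at most `δ` of them. Nor can crashes: a server of `G` can crash only
after `B`, so its repair starts after `B`, its `⌈(n+k)/2⌉` lists include `k` from `G`, and by
induction on time these contain the version, which is therefore restored. The same intersection
makes the version decodable for the read (`HasLists.decodable`). If no write has completed, the
initial version on all servers plays the same role.

Termination. A live process eventually sends all its messages; then `N1` yields enough responses,
reliable links deliver them, and the process takes its next step if one is enabled (`phase_ends`).
The only step that might not be enabled is the decoding step of a read, which is the case settled
above. -/

namespace Radon

noncomputable section

open scoped Classical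

/-! ### Evolution of a single call in one step. -/

section OneStep

variable {n k l : ℕ} {W R F : Type*}

/-- The change of a call of process `p` in a step that does not end it. -/
def CallStep (c : Config n k l W R F) (e : Event n k l W R F) (p : Proc n W R)
    (a a' : Call n l W F) : Prop :=
  (a' = a ∧ e.local? ≠ some p ∧ ∀ m : RespMsg n l W R F, m.dst = p → e ≠ .recvResp m) ∨
  (∃ i ∈ a.unsent, e = .send p i a.id ∧ a' = a.markSent i) ∨
  (∃ m ∈ c.resps, m.dst = p ∧ e = .recvResp m ∧ a' = a.accept m)

variable {c c' : Config n k l W R F} {e : Event n k l W R F} {p : Proc n W R}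
  {a a' : Call n l W F}

theorem Call.accept_fields (m : RespMsg n l W R F) (a : Call n l W F) :
    (a.accept m).id = a.id ∧ (a.accept m).msg = a.msg ∧ (a.accept m).need = a.need ∧
      (a.accept m).unsent = a.unsent := by
  unfold Call.accept
  split <;> simp

theorem CallStep.id_eq (h : CallStep c e p a a') : a'.id = a.id := by
  rcases h with ⟨rfl, -⟩ | ⟨i, -, -, rfl⟩ | ⟨m, -, -, -, rfl⟩
  · rfl
  · rfl
  · exact (Call.accept_fields m a).1

theorem CallStep.msg_eq (h : CallStep c e p a a') : a'.msg = a.msg := by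
  rcases h with ⟨rfl, -⟩ | ⟨i, -, -, rfl⟩ | ⟨m, -, -, -, rfl⟩
  · rfl
  · rfl
  · exact (Call.accept_fields m a).2.1

theorem CallStep.need_eq (h : CallStep c e p a a') : a'.need = a.need := by
  rcases h with ⟨rfl, -⟩ | ⟨i, -, -, rfl⟩ | ⟨m, -, -, -, rfl⟩
  · rfl
  · rfl
  · exact (Call.accept_fields m a).2.2.1

theorem CallStep.unsent_cases (h : CallStep c e p a a') :
    a'.unsent = a.unsent ∧ e.local? ≠ some p ∨
      ∃ i ∈ a.unsent, e = .send p i a.id ∧ a'.unsent = a.unsent.erase i := by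
  rcases h with ⟨rfl, h, -⟩ | ⟨i, hi, he, rfl⟩ | ⟨m, -, -, rfl, rfl⟩
  · exact .inl ⟨rfl, h⟩
  · exact .inr ⟨i, hi, he, rfl⟩
  · exact .inl ⟨(Call.accept_fields m a).2.2.2, by simp [Event.local?]⟩

theorem CallStep.got_cases (h : CallStep c e p a a') :
    a'.got = a.got ∨ ∃ m ∈ c.resps, m.dst = p ∧ m.id = a.id ∧ a.count < a.need ∧
      a'.got = Function.update a.got m.src (some m.body) := by
  rcases h with ⟨rfl, -⟩ | ⟨i, -, -, rfl⟩ | ⟨m, hm, hp, -, rfl⟩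
  · exact .inl rfl
  · exact .inl rfl
  · unfold Call.accept
    split
    next h => exact .inr ⟨m, hm, hp, h.1, h.2, rfl⟩
    next h => exact .inl rfl

/-- Nothing is left to send and surplus responses are ignored, so a completed call is frozen until
its process moves on. -/
theorem CallStep.eq_of_complete (h : CallStep c e p a a') (ha : a.Complete) : a' = a := by
  rcases h with ⟨rfl, -⟩ | ⟨i, hi, -⟩ | ⟨m, hm, hp, -, rfl⟩
  · rfl
  · simp [ha.1] at hi
  · unfold Call.accept
    rw [if_neg]
    rintro ⟨-, h⟩
    exact absurd ha.2 h.ne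

/-- Unlike `CallStep.eq_of_complete` this tolerates unsent messages: `HasLists` looks only at the
number of responses, and a read may have its lists before its last send. -/
theorem CallStep.got_eq_of_full (h : CallStep c e p a a') (ha : a.count = a.need) :
    a'.got = a.got := by
  rcases h.got_cases with h | ⟨m, -, -, -, h, -⟩
  · exact h
  · omega

theorem Call.count_congr (h : a'.got = a.got) : a'.count = a.count := by
  unfold Call.count
  rw [h]

theorem CallStep.isSome_mono (h : CallStep c e p a a') {i : Fin n} (hi : (a.got i).isSome) :
    (a'.got i).isSome := by
  rcases h.got_cases with h | ⟨m, -, -, -, -, h⟩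
  · rwa [h]
  · rw [h, Function.update_apply]
    split
    · rfl
    · exact hi

theorem CallStep.count_le_need (h : CallStep c e p a a') (ha : a.count ≤ a.need) :
    a'.count ≤ a'.need := by
  rw [h.need_eq]
  rcases h.got_cases with h | ⟨m, -, -, -, hlt, h⟩
  · rwa [Call.count_congr h]
  · refine le_trans ?_ (Nat.succ_le_of_lt hlt)
    refine le_trans (Finset.card_le_card ?_) (Finset.card_insert_le m.src _)
    intro i hi
    simp only [Finset.mem_filter, Finset.mem_univ, true_and, h, Function.update_apply,
      Finset.mem_insert] at hi ⊢
    by_cases hs : i = m.src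
    · exact .inl hs
    · rw [if_neg hs] at hi
      exact .inr hi

theorem WriterState.call?_mapCall (f : Call n l W F → Call n l W F)
    (s : WriterState n k l W F) : (s.mapCall f).call? = s.call?.map f := by
  cases s <;> rfl

theorem ReaderState.call?_mapCall (f : Call n l W F → Call n l W F)
    (s : ReaderState n k l W F) : (s.mapCall f).call? = s.call?.map f := by
  cases s <;> rfl

theorem ServerState.call?_mapCall (f : Call n l W F → Call n l W F)
    (s : ServerState n l W F) : (s.mapCall f).call? = s.call?.map f := by
  cases s <;> rfl

theorem Config.mapCall_messages (c : Config n k l W R F) (f : Call n l W F → Call n l W F)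
    (p : Proc n W R) : (c.mapCall f p).reqs = c.reqs ∧ (c.mapCall f p).resps = c.resps := by
  cases p <;> exact ⟨rfl, rfl⟩

theorem Config.call?_writer_getTag {i : W} {op : ℕ} {v : Value k l F}
    (h : c.writer i = .getTag op v a) : c.call? (.writer i) = some a := by
  simp only [Config.call?, h, WriterState.call?]

theorem Config.call?_writer_putData {i : W} {op : ℕ} {t : Tag W} {v : Value k l F}
    (h : c.writer i = .putData op t v a) : c.call? (.writer i) = some a := by
  simp only [Config.call?, h, WriterState.call?]

theorem Config.call?_reader_getData {i : R} {op : ℕ}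
    (h : c.reader i = .getData op a) : c.call? (.reader i) = some a := by
  simp only [Config.call?, h, ReaderState.call?]

theorem Config.call?_reader_putData {i : R} {op : ℕ} {t : Tag W} {v : Value k l F}
    (h : c.reader i = .putData op t v a) : c.call? (.reader i) = some a := by
  simp only [Config.call?, h, ReaderState.call?]

theorem Config.call?_server_repair {i : Fin n} {op : ℕ}
    (h : c.server i = .repair op a) : c.call? (.server i) = some a := by
  simp only [Config.call?, h, ServerState.call?]

end OneStep

/-! ### Case analysis of the transition relation, per process. -/

section Steps

variable {n k l : ℕ} {W R F : Type*} [LinearOrder W] [Field F] {P : System n k l W F}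
  {c c' : Config n k l W R F} {e : Event n k l W R F}

theorem Step.fresh_mono (h : Step P c e c') : c.fresh ≤ c'.fresh := by
  cases h with
  | send p a i h hi => cases p <;> exact le_rfl
  | recvResp m hm =>
    rcases m with ⟨_, _, d, _⟩
    cases d <;> exact le_rfl
  | _ => first | exact le_rfl | exact Nat.le_succ _

/-- With `Step.fresh_mono`, this is what makes identifiers of group-sends unique in an execution. -/
theorem Step.fresh_of_groupSend (h : Step P c e c') {p : Proc n W R} {id : ℕ}
    (he : e.groupSend? = some (p, id)) : id = c.fresh ∧ c'.fresh = c.fresh + 1 := by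
  cases h <;> simp only [Event.groupSend?, Option.some.injEq, Prod.mk.injEq, reduceCtorEq] at he
  all_goals exact ⟨he.2.symm, rfl⟩

/-- What a step does to the state of a writer. -/
theorem Step.writer_cases (h : Step P c e c') (i : W) :
    (c'.writer i = c.writer i ∧ e.local? ≠ some (.writer i) ∧
      ∀ m : RespMsg n l W R F, m.dst = .writer i → e ≠ .recvResp m) ∨
    (∃ f, c'.writer i = (c.writer i).mapCall f ∧
      ∀ a, (c.writer i).call? = some a → CallStep c e (.writer i) a (f a)) ∨
    (∃ v, e = .invokeWrite i c.fresh v ∧ c.writer i = .idle ∧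
      c'.writer i = .getTag c.fresh v (Call.start c.fresh (n / 2 + 1) fun _ => .queryTag)) ∨
    (∃ op v a s t, e = .writePut i op (toLex ((ofLex t).1 + 1, i)) c.fresh ∧
      c.writer i = .getTag op v a ∧ a.Complete ∧ a.got s = some (.tag t) ∧
      c'.writer i = .putData op (toLex ((ofLex t).1 + 1, i)) v
        (Call.start c.fresh ((3 * n + k) ⌈/⌉ 4) (codeElems P (toLex ((ofLex t).1 + 1, i)) v))) ∨
    (∃ op t v a, e = .writeDone i op ∧ c.writer i = .putData op t v a ∧ a.Complete ∧
      c'.writer i = .idle) ∨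
    (e = .failWriter i ∧ c'.writer i = .failed) := by
  cases h with
  | invokeWrite j v h =>
    by_cases hj : i = j
    · subst hj
      exact .inr (.inr (.inl ⟨v, rfl, h, by simp [Config.tick, Config.setWriter]⟩))
    · left; simp [Config.tick, Config.setWriter, Event.local?, hj]
  | writePut j op v a t h ha ht hmax =>
    by_cases hj : i = j
    · subst hj
      obtain ⟨s, hs⟩ := ht
      exact .inr (.inr (.inr (.inl ⟨op, v, a, s, t, rfl, h, ha, hs,
        by simp [Config.tick, Config.setWriter]⟩)))
    · left; simp [Config.tick, Config.setWriter, Event.local?, hj, Ne.symm hj]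
  | writeDone j op t v a h ha =>
    by_cases hj : i = j
    · subst hj
      exact .inr (.inr (.inr (.inr (.inl ⟨op, t, v, a, rfl, h, ha,
        by simp [Config.setWriter]⟩))))
    · left; simp [Config.setWriter, Event.local?, hj, Ne.symm hj]
  | failWriter j h =>
    by_cases hj : i = j
    · subst hj
      exact .inr (.inr (.inr (.inr (.inr ⟨rfl, by simp [Config.setWriter]⟩))))
    · left; simp [Config.setWriter, Event.local?, hj]
  | send p a j h hi =>
    by_cases hp : p = .writer i
    · subst hp
      refine .inr (.inl ⟨Call.markSent j, by simp [Config.mapCall, Config.setWriter], ?_⟩)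
      intro b hb
      simp only [Config.call?] at h
      obtain rfl : a = b := by simpa [h] using hb
      exact .inr (.inl ⟨j, hi, rfl, rfl⟩)
    · left
      refine ⟨?_, by simpa [Event.local?] using hp, by simp⟩
      cases p with
      | writer q =>
        have : i ≠ q := fun h => hp (by rw [h])
        simp [Config.mapCall, Config.setWriter, this]
      | _ => rfl
  | recvResp m hm =>
    by_cases hp : m.dst = .writer i
    · refine .inr (.inl ⟨Call.accept m, by simp [hp, Config.mapCall, Config.setWriter], ?_⟩)
      intro b _
      exact .inr (.inr ⟨m, hm, hp, rfl, rfl⟩)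
    · left
      refine ⟨?_, by simp [Event.local?], ?_⟩
      · rcases m with ⟨_, _, d, _⟩
        cases d with
        | writer q =>
          have : i ≠ q := fun h => hp (by rw [h])
          simp [Config.mapCall, Config.setWriter, this]
        | _ => rfl
      · rintro m' h h'
        cases h'
        exact hp h
  | _ => left; exact ⟨rfl, by simp [Event.local?], by simp⟩

/-- What a step does to the state of a reader. -/
theorem Step.reader_cases (h : Step P c e c') (i : R) :
    (c'.reader i = c.reader i ∧ e.local? ≠ some (.reader i) ∧
      ∀ m : RespMsg n l W R F, m.dst = .reader i → e ≠ .recvResp m) ∨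
    (∃ f, c'.reader i = (c.reader i).mapCall f ∧
      ∀ a, (c.reader i).call? = some a → CallStep c e (.reader i) a (f a)) ∨
    (e = .invokeRead i c.fresh ∧ c.reader i = .idle ∧
      c'.reader i = .getData c.fresh (Call.start c.fresh ((n + k) ⌈/⌉ 2) fun _ => .queryList)) ∨
    (∃ op a t v, e = .readPut i op t v c.fresh ∧
      c.reader i = .getData op a ∧ a.Complete ∧ Decodable P.gen a.got t v ∧
      c'.reader i = .putData op t v
        (Call.start c.fresh ((3 * n + k) ⌈/⌉ 4) (codeElems P t v))) ∨
    (∃ op t v a, e = .readDone i op v ∧ c.reader i = .putData op t v a ∧ a.Complete ∧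
      c'.reader i = .idle) ∨
    (e = .failReader i ∧ c'.reader i = .failed) := by
  cases h with
  | invokeRead j h =>
    by_cases hj : i = j
    · subst hj
      exact .inr (.inr (.inl ⟨rfl, h, by simp [Config.tick, Config.setReader]⟩))
    · left; simp [Config.tick, Config.setReader, Event.local?, hj]
  | readPut j op a t v h ha hd hmax =>
    by_cases hj : i = j
    · subst hj
      exact .inr (.inr (.inr (.inl ⟨op, a, t, v, rfl, h, ha, hd,
        by simp [Config.tick, Config.setReader]⟩)))
    · left; simp [Config.tick, Config.setReader, Event.local?, hj, Ne.symm hj]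
  | readDone j op t v a h ha =>
    by_cases hj : i = j
    · subst hj
      exact .inr (.inr (.inr (.inr (.inl ⟨op, t, v, a, rfl, h, ha,
        by simp [Config.setReader]⟩))))
    · left; simp [Config.setReader, Event.local?, hj, Ne.symm hj]
  | failReader j h =>
    by_cases hj : i = j
    · subst hj
      exact .inr (.inr (.inr (.inr (.inr ⟨rfl, by simp [Config.setReader]⟩))))
    · left; simp [Config.setReader, Event.local?, hj]
  | send p a j h hi =>
    by_cases hp : p = .reader i
    · subst hp
      refine .inr (.inl ⟨Call.markSent j, by simp [Config.mapCall, Config.setReader], ?_⟩)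
      intro b hb
      simp only [Config.call?] at h
      obtain rfl : a = b := by simpa [h] using hb
      exact .inr (.inl ⟨j, hi, rfl, rfl⟩)
    · left
      refine ⟨?_, by simpa [Event.local?] using hp, by simp⟩
      cases p with
      | reader q =>
        have : i ≠ q := fun h => hp (by rw [h])
        simp [Config.mapCall, Config.setReader, this]
      | _ => rfl
  | recvResp m hm =>
    by_cases hp : m.dst = .reader i
    · refine .inr (.inl ⟨Call.accept m, by simp [hp, Config.mapCall, Config.setReader], ?_⟩)
      intro b _
      exact .inr (.inr ⟨m, hm, hp, rfl, rfl⟩)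
    · left
      refine ⟨?_, by simp [Event.local?], ?_⟩
      · rcases m with ⟨_, _, d, _⟩
        cases d with
        | reader q =>
          have : i ≠ q := fun h => hp (by rw [h])
          simp [Config.mapCall, Config.setReader, this]
        | _ => rfl
      · rintro m' h h'
        cases h'
        exact hp h
  | _ => left; exact ⟨rfl, by simp [Event.local?], by simp⟩

/-- What a step does to the state of a server. -/
theorem Step.server_cases (h : Step P c e c') (i : Fin n) :
    (c'.server i = c.server i ∧ e.local? ≠ some (.server i) ∧
      ∀ m : RespMsg n l W R F, m.dst = .server i → e ≠ .recvResp m) ∨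
    (∃ f, c'.server i = (c.server i).mapCall f ∧
      ∀ a, (c.server i).call? = some a → CallStep c e (.server i) a (f a)) ∨
    (∃ m L, e = .recvReq m ∧ m ∈ c.reqs ∧ m.dst = i ∧ c.server i = .active L ∧
      c'.server i = .active (serve P L m.body).1) ∨
    (e = .crash i ∧ c'.server i = .crashed) ∨
    (e = .repairStart i c.fresh ∧ c.server i = .crashed ∧
      c'.server i = .repair c.fresh
        (Call.start c.fresh ((n + k) ⌈/⌉ 2) fun _ => .repairList)) ∨
    (∃ op a D, e = .repairDone i op ∧ c.server i = .repair op a ∧ a.Complete ∧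
      (∀ t x, (t, x) ∈ D ↔ ∃ v, Decodable P.gen a.got t v ∧ x = encode P.gen v i) ∧
      c'.server i = .active (prune P.delta D)) := by
  cases h with
  | recvReq m L hm h =>
    by_cases hj : m.dst = i
    · subst hj
      exact .inr (.inr (.inl ⟨m, L, rfl, hm, rfl, h, by simp [Config.setServer]⟩))
    · left; simp [Config.setServer, Event.local?, Ne.symm hj]
  | crash j h =>
    by_cases hj : i = j
    · subst hj
      exact .inr (.inr (.inr (.inl ⟨rfl, by simp [Config.setServer]⟩)))
    · left; simp [Config.setServer, Event.local?, hj]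
  | repairStart j h =>
    by_cases hj : i = j
    · subst hj
      exact .inr (.inr (.inr (.inr (.inl ⟨rfl, h, by simp [Config.tick, Config.setServer]⟩))))
    · left; simp [Config.tick, Config.setServer, Event.local?, hj]
  | repairDone j op a D h ha hD =>
    by_cases hj : i = j
    · subst hj
      exact .inr (.inr (.inr (.inr (.inr ⟨op, a, D, rfl, h, ha, hD,
        by simp [Config.setServer]⟩))))
    · left; simp [Config.setServer, Event.local?, hj, Ne.symm hj]
  | send p a j h hi =>
    by_cases hp : p = .server i
    · subst hp
      refine .inr (.inl ⟨Call.markSent j, by simp [Config.mapCall, Config.setServer], ?_⟩)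
      intro b hb
      simp only [Config.call?] at h
      obtain rfl : a = b := by simpa [h] using hb
      exact .inr (.inl ⟨j, hi, rfl, rfl⟩)
    · left
      refine ⟨?_, by simpa [Event.local?] using hp, by simp⟩
      cases p with
      | server q =>
        have : i ≠ q := fun h => hp (by rw [h])
        simp [Config.mapCall, Config.setServer, this]
      | _ => rfl
  | recvResp m hm =>
    by_cases hp : m.dst = .server i
    · refine .inr (.inl ⟨Call.accept m, by simp [hp, Config.mapCall, Config.setServer], ?_⟩)
      intro b _
      exact .inr (.inr ⟨m, hm, hp, rfl, rfl⟩)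
    · left
      refine ⟨?_, by simp [Event.local?], ?_⟩
      · rcases m with ⟨_, _, d, _⟩
        cases d with
        | server q =>
          have : i ≠ q := fun h => hp (by rw [h])
          simp [Config.mapCall, Config.setServer, this]
        | _ => rfl
      · rintro m' h h'
        cases h'
        exact hp h
  | _ => left; exact ⟨rfl, by simp [Event.local?], by simp⟩

/-- A call in progress after a step has just been started or was in progress before. -/
theorem Step.call_backward (h : Step P c e c') {p : Proc n W R} {a' : Call n l W F}
    (ha : c'.call? p = some a') :
    (e.groupSend? = some (p, a'.id) ∧ ∃ need msg, a' = Call.start c.fresh need msg) ∨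
      ∃ a, c.call? p = some a ∧ CallStep c e p a a' := by
  cases p with
  | writer i =>
    simp only [Config.call?] at ha ⊢
    rcases h.writer_cases i with ⟨hs, h⟩ | ⟨f, hs, hf⟩ | ⟨v, rfl, -, hs⟩ |
      ⟨op, v, a, s, t, rfl, -, -, -, hs⟩ | ⟨op, t, v, a, -, -, -, hs⟩ | ⟨-, hs⟩
    · exact .inr ⟨a', hs ▸ ha, .inl ⟨rfl, h⟩⟩
    · rw [hs, WriterState.call?_mapCall, Option.map_eq_some_iff] at ha
      obtain ⟨a, ha, rfl⟩ := ha
      exact .inr ⟨a, ha, hf a ha⟩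
    all_goals
      rw [hs] at ha
      simp only [WriterState.call?, Option.some.injEq, reduceCtorEq] at ha
    all_goals
      subst ha
      exact .inl ⟨rfl, _, _, rfl⟩
  | reader i =>
    simp only [Config.call?] at ha ⊢
    rcases h.reader_cases i with ⟨hs, h⟩ | ⟨f, hs, hf⟩ | ⟨rfl, -, hs⟩ |
      ⟨op, a, t, v, rfl, -, -, -, hs⟩ | ⟨op, t, v, a, -, -, -, hs⟩ | ⟨-, hs⟩
    · exact .inr ⟨a', hs ▸ ha, .inl ⟨rfl, h⟩⟩
    · rw [hs, ReaderState.call?_mapCall, Option.map_eq_some_iff] at ha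
      obtain ⟨a, ha, rfl⟩ := ha
      exact .inr ⟨a, ha, hf a ha⟩
    all_goals
      rw [hs] at ha
      simp only [ReaderState.call?, Option.some.injEq, reduceCtorEq] at ha
    all_goals
      subst ha
      exact .inl ⟨rfl, _, _, rfl⟩
  | server i =>
    simp only [Config.call?] at ha ⊢
    rcases h.server_cases i with ⟨hs, h⟩ | ⟨f, hs, hf⟩ | ⟨m, L, -, -, -, -, hs⟩ |
      ⟨-, hs⟩ | ⟨rfl, -, hs⟩ | ⟨op, a, D, -, -, -, -, hs⟩
    · exact .inr ⟨a', hs ▸ ha, .inl ⟨rfl, h⟩⟩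
    · rw [hs, ServerState.call?_mapCall, Option.map_eq_some_iff] at ha
      obtain ⟨a, ha, rfl⟩ := ha
      exact .inr ⟨a, ha, hf a ha⟩
    all_goals
      rw [hs] at ha
      simp only [ServerState.call?, Option.some.injEq, reduceCtorEq] at ha
    all_goals
      subst ha
      exact .inl ⟨rfl, _, _, rfl⟩

/-- A call stays in progress until it is complete and its process goes on, or its process fails. -/
theorem Step.call_forward (h : Step P c e c') {p : Proc n W R} {a : Call n l W F}
    (ha : c.call? p = some a) :
    (∃ a', c'.call? p = some a' ∧ CallStep c e p a a') ∨
      (e.local? = some p ∧ a.Complete) ∨ c'.Down p := by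
  cases p with
  | writer i =>
    simp only [Config.call?] at ha ⊢
    rcases h.writer_cases i with ⟨hs, h⟩ | ⟨f, hs, hf⟩ | ⟨v, -, hs, -⟩ |
      ⟨op, v, b, s, t, rfl, hs, hb, -⟩ | ⟨op, t, v, b, rfl, hs, hb, -⟩ | ⟨-, hs⟩
    · exact .inl ⟨a, hs ▸ ha, .inl ⟨rfl, h⟩⟩
    · exact .inl ⟨f a, by rw [hs, WriterState.call?_mapCall, ha]; rfl, hf a ha⟩
    · simp [hs, WriterState.call?] at ha
    · simp only [hs, WriterState.call?, Option.some.injEq] at ha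
      exact .inr (.inl ⟨rfl, ha ▸ hb⟩)
    · simp only [hs, WriterState.call?, Option.some.injEq] at ha
      exact .inr (.inl ⟨rfl, ha ▸ hb⟩)
    · exact .inr (.inr hs)
  | reader i =>
    simp only [Config.call?] at ha ⊢
    rcases h.reader_cases i with ⟨hs, h⟩ | ⟨f, hs, hf⟩ | ⟨-, hs, -⟩ |
      ⟨op, b, t, v, rfl, hs, hb, -⟩ | ⟨op, t, v, b, rfl, hs, hb, -⟩ | ⟨-, hs⟩
    · exact .inl ⟨a, hs ▸ ha, .inl ⟨rfl, h⟩⟩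
    · exact .inl ⟨f a, by rw [hs, ReaderState.call?_mapCall, ha]; rfl, hf a ha⟩
    · simp [hs, ReaderState.call?] at ha
    · simp only [hs, ReaderState.call?, Option.some.injEq] at ha
      exact .inr (.inl ⟨rfl, ha ▸ hb⟩)
    · simp only [hs, ReaderState.call?, Option.some.injEq] at ha
      exact .inr (.inl ⟨rfl, ha ▸ hb⟩)
    · exact .inr (.inr hs)
  | server i =>
    simp only [Config.call?] at ha ⊢
    rcases h.server_cases i with ⟨hs, h⟩ | ⟨f, hs, hf⟩ | ⟨m, L, -, -, -, hs, -⟩ |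
      ⟨-, hs⟩ | ⟨-, hs, -⟩ | ⟨op, b, D, rfl, hs, hb, -⟩
    · exact .inl ⟨a, hs ▸ ha, .inl ⟨rfl, h⟩⟩
    · exact .inl ⟨f a, by rw [hs, ServerState.call?_mapCall, ha]; rfl, hf a ha⟩
    · simp [hs, ServerState.call?] at ha
    · exact .inr (.inr hs)
    · simp [hs, ServerState.call?] at ha
    · simp only [hs, ServerState.call?, Option.some.injEq] at ha
      exact .inr (.inl ⟨rfl, ha ▸ hb⟩)

theorem Step.mem_reqs (h : Step P c e c') {m : ReqMsg n l W R F} (hm : m ∈ c'.reqs) :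
    m ∈ c.reqs ∨ ∃ a, c.call? m.src = some a ∧ m.id = a.id ∧ m.body = a.msg m.dst := by
  cases h with
  | send p a i h hi =>
    rcases hm with rfl | hm
    · exact .inr ⟨a, h, rfl, rfl⟩
    · exact .inl hm
  | recvReq m' L hm' h => exact .inl hm.1
  | loseReq m' hm' h => exact .inl hm.1
  | recvResp m' hm' =>
    left
    simpa [(c.mapCall_messages _ _).1] using hm
  | _ => exact .inl hm

/-- Only an active server produces a response. Its state before and after is recorded so that later
arguments can speak of server lists instead of messages. -/
theorem Step.mem_resps (h : Step P c e c') {m : RespMsg n l W R F} (hm : m ∈ c'.resps) :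
    m ∈ c.resps ∨ ∃ m' L, m' ∈ c.reqs ∧ c.server m'.dst = .active L ∧
      c'.server m'.dst = .active (serve P L m'.body).1 ∧
      m = ⟨m'.id, m'.dst, m'.src, (serve P L m'.body).2⟩ := by
  cases h with
  | send p a i h hi =>
    left
    simpa [(c.mapCall_messages _ _).2] using hm
  | recvReq m' L hm' h =>
    rcases hm with rfl | hm
    · exact .inr ⟨m', L, hm', h, by simp [Config.setServer], rfl⟩
    · exact .inl hm
  | recvResp m' hm' => exact .inl hm.1
  | _ => exact .inl hm

end Steps

/-! ### Tracing states, calls and messages back to the events that created them. -/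

section Histories

variable {n k l : ℕ} {W R F : Type*} [LinearOrder W] [Field F] {P : System n k l W F}
  {c c' : Config n k l W R F} {e : Event n k l W R F}

theorem Step.writer_getTag (h : Step P c e c') {i : W} {op : ℕ} {v : Value k l F}
    {a' : Call n l W F} (hs : c'.writer i = .getTag op v a') :
    (e = .invokeWrite i op v ∧ a' = Call.start op (n / 2 + 1) fun _ => .queryTag) ∨
      ∃ a, c.writer i = .getTag op v a ∧ CallStep c e (.writer i) a a' := by
  rcases h.writer_cases i with ⟨hs', h⟩ | ⟨f, hs', hf⟩ | ⟨v, rfl, -, hs'⟩ |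
    ⟨_, v, a, s, t, rfl, -, -, -, hs'⟩ | ⟨_, t, v, a, -, -, -, hs'⟩ | ⟨-, hs'⟩
  · exact .inr ⟨a', hs' ▸ hs, .inl ⟨rfl, h⟩⟩
  · rw [hs'] at hs
    cases hw : c.writer i <;> rw [hw] at hs <;>
      simp only [WriterState.mapCall, WriterState.getTag.injEq, reduceCtorEq] at hs
    obtain ⟨rfl, rfl, rfl⟩ := hs
    exact .inr ⟨_, rfl, hf _ (by rw [hw]; rfl)⟩
  all_goals
    rw [hs'] at hs
    simp only [WriterState.getTag.injEq, reduceCtorEq] at hs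
  obtain ⟨rfl, rfl, rfl⟩ := hs
  exact .inl ⟨rfl, rfl⟩

theorem Step.writer_putData (h : Step P c e c') {i : W} {op : ℕ} {t : Tag W} {v : Value k l F}
    {a' : Call n l W F} (hs : c'.writer i = .putData op t v a') :
    (e = .writePut i op t a'.id ∧
      a' = Call.start c.fresh ((3 * n + k) ⌈/⌉ 4) (codeElems P t v)) ∨
      ∃ a, c.writer i = .putData op t v a ∧ CallStep c e (.writer i) a a' := by
  rcases h.writer_cases i with ⟨hs', h⟩ | ⟨f, hs', hf⟩ | ⟨v, rfl, -, hs'⟩ |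
    ⟨_, v, a, s, t, rfl, -, -, -, hs'⟩ | ⟨_, t, v, a, -, -, -, hs'⟩ | ⟨-, hs'⟩
  · exact .inr ⟨a', hs' ▸ hs, .inl ⟨rfl, h⟩⟩
  · rw [hs'] at hs
    cases hw : c.writer i <;> rw [hw] at hs <;>
      simp only [WriterState.mapCall, WriterState.putData.injEq, reduceCtorEq] at hs
    obtain ⟨rfl, rfl, rfl, rfl⟩ := hs
    exact .inr ⟨_, rfl, hf _ (by rw [hw]; rfl)⟩
  all_goals
    rw [hs'] at hs
    simp only [WriterState.putData.injEq, reduceCtorEq] at hs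
  obtain ⟨rfl, rfl, rfl, rfl⟩ := hs
  exact .inl ⟨rfl, rfl⟩

theorem Step.reader_getData (h : Step P c e c') {i : R} {op : ℕ}
    {a' : Call n l W F} (hs : c'.reader i = .getData op a') :
    (e = .invokeRead i op ∧ a' = Call.start op ((n + k) ⌈/⌉ 2) fun _ => .queryList) ∨
      ∃ a, c.reader i = .getData op a ∧ CallStep c e (.reader i) a a' := by
  rcases h.reader_cases i with ⟨hs', h⟩ | ⟨f, hs', hf⟩ | ⟨rfl, -, hs'⟩ |
    ⟨_, a, t, v, rfl, -, -, -, hs'⟩ | ⟨_, t, v, a, -, -, -, hs'⟩ | ⟨-, hs'⟩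
  · exact .inr ⟨a', hs' ▸ hs, .inl ⟨rfl, h⟩⟩
  · rw [hs'] at hs
    cases hw : c.reader i <;> rw [hw] at hs <;>
      simp only [ReaderState.mapCall, ReaderState.getData.injEq, reduceCtorEq] at hs
    obtain ⟨rfl, rfl⟩ := hs
    exact .inr ⟨_, rfl, hf _ (by rw [hw]; rfl)⟩
  all_goals
    rw [hs'] at hs
    simp only [ReaderState.getData.injEq, reduceCtorEq] at hs
  obtain ⟨rfl, rfl⟩ := hs
  exact .inl ⟨rfl, rfl⟩

theorem Step.reader_putData (h : Step P c e c') {i : R} {op : ℕ} {t : Tag W} {v : Value k l F}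
    {a' : Call n l W F} (hs : c'.reader i = .putData op t v a') :
    (e = .readPut i op t v a'.id ∧
      a' = Call.start c.fresh ((3 * n + k) ⌈/⌉ 4) (codeElems P t v)) ∨
      ∃ a, c.reader i = .putData op t v a ∧ CallStep c e (.reader i) a a' := by
  rcases h.reader_cases i with ⟨hs', h⟩ | ⟨f, hs', hf⟩ | ⟨rfl, -, hs'⟩ |
    ⟨_, a, t, v, rfl, -, -, -, hs'⟩ | ⟨_, t, v, a, -, -, -, hs'⟩ | ⟨-, hs'⟩
  · exact .inr ⟨a', hs' ▸ hs, .inl ⟨rfl, h⟩⟩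
  · rw [hs'] at hs
    cases hw : c.reader i <;> rw [hw] at hs <;>
      simp only [ReaderState.mapCall, ReaderState.putData.injEq, reduceCtorEq] at hs
    obtain ⟨rfl, rfl, rfl, rfl⟩ := hs
    exact .inr ⟨_, rfl, hf _ (by rw [hw]; rfl)⟩
  all_goals
    rw [hs'] at hs
    simp only [ReaderState.putData.injEq, reduceCtorEq] at hs
  obtain ⟨rfl, rfl, rfl, rfl⟩ := hs
  exact .inl ⟨rfl, rfl⟩

theorem Step.server_repair (h : Step P c e c') {i : Fin n} {op : ℕ}
    {a' : Call n l W F} (hs : c'.server i = .repair op a') :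
    (e = .repairStart i op ∧ c.server i = .crashed ∧
      a' = Call.start op ((n + k) ⌈/⌉ 2) fun _ => .repairList) ∨
      ∃ a, c.server i = .repair op a ∧ CallStep c e (.server i) a a' := by
  rcases h.server_cases i with ⟨hs', h⟩ | ⟨f, hs', hf⟩ | ⟨m, L, -, -, -, -, hs'⟩ |
    ⟨-, hs'⟩ | ⟨rfl, hc, hs'⟩ | ⟨_, a, D, -, -, -, -, hs'⟩
  · exact .inr ⟨a', hs' ▸ hs, .inl ⟨rfl, h⟩⟩
  · rw [hs'] at hs
    cases hw : c.server i <;> rw [hw] at hs <;>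
      simp only [ServerState.mapCall, ServerState.repair.injEq, reduceCtorEq] at hs
    obtain ⟨rfl, rfl⟩ := hs
    exact .inr ⟨_, rfl, hf _ (by rw [hw]; rfl)⟩
  all_goals
    rw [hs'] at hs
    simp only [ServerState.repair.injEq, reduceCtorEq] at hs
  obtain ⟨rfl, rfl⟩ := hs
  exact .inl ⟨rfl, hc, rfl⟩

theorem Step.server_active (h : Step P c e c') {i : Fin n} {L' : VList l W F}
    (hs : c'.server i = .active L') :
    c.server i = .active L' ∨
    (∃ m L, m ∈ c.reqs ∧ m.dst = i ∧ c.server i = .active L ∧ L' = (serve P L m.body).1) ∨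
    (∃ op a D, c.server i = .repair op a ∧ a.Complete ∧
      (∀ t x, (t, x) ∈ D ↔ ∃ v, Decodable P.gen a.got t v ∧ x = encode P.gen v i) ∧
      L' = prune P.delta D) := by
  rcases h.server_cases i with ⟨hs', h⟩ | ⟨f, hs', hf⟩ | ⟨m, L, -, hm, hd, hL, hs'⟩ |
    ⟨-, hs'⟩ | ⟨-, -, hs'⟩ | ⟨op, a, D, -, hr, ha, hD, hs'⟩
  · exact .inl (hs' ▸ hs)
  · rw [hs'] at hs
    cases hw : c.server i <;> rw [hw] at hs <;>
      simp only [ServerState.mapCall, ServerState.active.injEq, reduceCtorEq] at hs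
    subst hs
    exact .inl rfl
  all_goals
    rw [hs'] at hs
    simp only [ServerState.active.injEq, reduceCtorEq] at hs
  · exact .inr (.inl ⟨m, L, hm, hd, hL, hs.symm⟩)
  · exact .inr (.inr ⟨op, a, D, hr, ha, hD, hs.symm⟩)

namespace Execution

variable (β : Execution R P)

theorem fresh_mono : Monotone fun τ => (β.cfg τ).fresh :=
  monotone_nat_of_le_succ fun τ => (β.step τ).fresh_mono

variable {β}

theorem groupSend_time_unique {T T' id : ℕ} {p p' : Proc n W R}
    (h : (β.ev T).groupSend? = some (p, id)) (h' : (β.ev T').groupSend? = some (p', id)) :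
    T = T' := by
  have key : ∀ {T T' : ℕ} {p p' : Proc n W R}, (β.ev T).groupSend? = some (p, id) →
      (β.ev T').groupSend? = some (p', id) → ¬ T < T' := by
    intro T T' p p' h h' hlt
    have h1 := (β.step T).fresh_of_groupSend h
    have h2 := (β.step T').fresh_of_groupSend h'
    have h3 : (β.cfg (T + 1)).fresh ≤ (β.cfg T').fresh := β.fresh_mono hlt
    omega
  exact le_antisymm (not_lt.1 (key h' h)) (not_lt.1 (key h h'))

variable (β) in
/-- The group-send `id` of process `p` is invoked in event `T`, with the given messages and
number of awaited responses. -/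
def Begun (T : ℕ) (p : Proc n W R) (id need : ℕ) (msg : Fin n → Req l W F) : Prop :=
  (β.ev T).groupSend? = some (p, id) ∧
    (β.cfg (T + 1)).call? p = some (Call.start id need msg)

/-- Messages and responses carry only the identifier; it determines the invocation, its sender and
the messages sent. -/
theorem Begun.unique {T T' id need need' : ℕ} {p p' : Proc n W R} {msg msg' : Fin n → Req l W F}
    (h : β.Begun T p id need msg) (h' : β.Begun T' p' id need' msg') :
    T = T' ∧ p = p' ∧ need = need' ∧ msg = msg' := by
  obtain rfl := groupSend_time_unique h.1 h'.1
  have hp : p = p' := by simpa [h.1] using h'.1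
  subst hp
  have hc := h.2.symm.trans h'.2
  simp only [Call.start, Option.some.injEq, Call.mk.injEq, true_and, and_true] at hc
  exact ⟨rfl, rfl, hc.2, hc.1⟩

theorem call_begun {τ : ℕ} {p : Proc n W R} {a : Call n l W F}
    (h : (β.cfg τ).call? p = some a) : ∃ T < τ, β.Begun T p a.id a.need a.msg := by
  induction τ generalizing a with
  | zero =>
    rw [β.start] at h
    cases p <;> simp [Config.init, Config.call?, WriterState.call?, ReaderState.call?,
      ServerState.call?] at h
  | succ τ ih =>
    rcases (β.step τ).call_backward h with ⟨he, need, msg, rfl⟩ | ⟨b, hb, hba⟩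
    · exact ⟨τ, τ.lt_succ_self, he, h⟩
    · obtain ⟨T, hT, hB⟩ := ih hb
      exact ⟨T, hT.trans τ.lt_succ_self, by rwa [hba.id_eq, hba.need_eq, hba.msg_eq]⟩

theorem call_count_le {τ : ℕ} {p : Proc n W R} {a : Call n l W F}
    (h : (β.cfg τ).call? p = some a) : a.count ≤ a.need := by
  induction τ generalizing a with
  | zero =>
    rw [β.start] at h
    cases p <;> simp [Config.init, Config.call?, WriterState.call?, ReaderState.call?,
      ServerState.call?] at h
  | succ τ ih =>
    rcases (β.step τ).call_backward h with ⟨he, need, msg, rfl⟩ | ⟨b, hb, hba⟩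
    · simp [Call.count, Call.start]
    · exact hba.count_le_need (ih hb)

/-- `N1` applies only to group-sends that were not cut short; this supplies the send events it asks
for. -/
theorem call_sent {τ : ℕ} {p : Proc n W R} {a : Call n l W F}
    (h : (β.cfg τ).call? p = some a) {i : Fin n} (hi : i ∉ a.unsent) :
    ∃ τ', β.ev τ' = .send p i a.id := by
  induction τ generalizing a with
  | zero =>
    rw [β.start] at h
    cases p <;> simp [Config.init, Config.call?, WriterState.call?, ReaderState.call?,
      ServerState.call?] at h
  | succ τ ih =>
    rcases (β.step τ).call_backward h with ⟨he, need, msg, rfl⟩ | ⟨b, hb, hba⟩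
    · simp [Call.start] at hi
    · rw [hba.id_eq]
      rcases hba.unsent_cases with ⟨hu, -⟩ | ⟨j, -, he, hu⟩
      · exact ih hb (hu ▸ hi)
      · by_cases hij : i = j
        · exact ⟨τ, hij ▸ he⟩
        · exact ih hb fun hib => hi (hu ▸ Finset.mem_erase.2 ⟨hij, hib⟩)

theorem req_begun {τ : ℕ} {m : ReqMsg n l W R F} (h : m ∈ (β.cfg τ).reqs) :
    ∃ T < τ, ∃ need msg, β.Begun T m.src m.id need msg ∧ m.body = msg m.dst := by
  induction τ with
  | zero =>
    rw [β.start] at h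
    exact absurd h (Set.notMem_empty m)
  | succ τ ih =>
    rcases (β.step τ).mem_reqs h with h | ⟨a, ha, hid, hbody⟩
    · obtain ⟨T, hT, h⟩ := ih h
      exact ⟨T, hT.trans τ.lt_succ_self, h⟩
    · obtain ⟨T, hT, hB⟩ := call_begun ha
      exact ⟨T, hT.trans τ.lt_succ_self, _, _, hid ▸ hB, hbody⟩

variable (β) in
/-- Strictly between the times `T` and `τ`, server `i` consumes the message `b` and responds with
`r`. -/
def Answered (T τ : ℕ) (i : Fin n) (b : Req l W F) (r : Resp l W F) : Prop :=
  ∃ τ', T < τ' ∧ τ' < τ ∧ ∃ L, (β.cfg τ').server i = .active L ∧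
    (β.cfg (τ' + 1)).server i = .active (serve P L b).1 ∧ r = (serve P L b).2

theorem Answered.mono {T τ τ' : ℕ} {i : Fin n} {b : Req l W F} {r : Resp l W F}
    (h : β.Answered T τ i b r) (hτ : τ ≤ τ') : β.Answered T τ' i b r := by
  obtain ⟨σ, h1, h2, h⟩ := h
  exact ⟨σ, h1, h2.trans_le hτ, h⟩

theorem resp_answered {τ : ℕ} {m : RespMsg n l W R F} (h : m ∈ (β.cfg τ).resps) :
    ∃ T need msg, β.Begun T m.dst m.id need msg ∧
      β.Answered T τ m.src (msg m.src) m.body := by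
  induction τ with
  | zero =>
    rw [β.start] at h
    exact absurd h (Set.notMem_empty m)
  | succ τ ih =>
    rcases (β.step τ).mem_resps h with h | ⟨m', L, hm', hL, hL', rfl⟩
    · obtain ⟨T, need, msg, hB, hA⟩ := ih h
      exact ⟨T, need, msg, hB, hA.mono τ.le_succ⟩
    · obtain ⟨T, hT, need, msg, hB, hbody⟩ := req_begun hm'
      rw [hbody] at hL'
      exact ⟨T, need, msg, hB, τ, hT, τ.lt_succ_self, L, hL, hL', by rw [hbody]⟩

/-- The bridge from what a process knows to what servers stored: each collected response was
computed by an active server strictly after the invocation and strictly before now. -/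
theorem got_answered {τ T need : ℕ} {p : Proc n W R} {a : Call n l W F}
    {msg : Fin n → Req l W F} (h : (β.cfg τ).call? p = some a)
    (hB : β.Begun T p a.id need msg) {i : Fin n} {r : Resp l W F} (hr : a.got i = some r) :
    β.Answered T τ i (msg i) r := by
  induction τ generalizing a with
  | zero =>
    rw [β.start] at h
    cases p <;> simp [Config.init, Config.call?, WriterState.call?, ReaderState.call?,
      ServerState.call?] at h
  | succ τ ih =>
    rcases (β.step τ).call_backward h with ⟨he, need, msg, rfl⟩ | ⟨b, hb, hba⟩
    · simp [Call.start] at hr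
    · rw [hba.id_eq] at hB
      rcases hba.got_cases with hg | ⟨m, hm, hd, hid, -, hg⟩
      · exact (ih hb hB (hg ▸ hr)).mono τ.le_succ
      · rw [hg, Function.update_apply] at hr
        split at hr
        next hi =>
          -- The accepted response bears the identifier of the call, so it answers this very
          -- group-send.
          obtain ⟨T', need', msg', hB', hA⟩ := resp_answered hm
          rw [hid] at hB'
          obtain ⟨rfl, -, -, rfl⟩ := hB.unique hB'
          cases hr
          subst hi
          exact hA.mono τ.le_succ
        next hi => exact (ih hb hB hr).mono τ.le_succ

/-- The last clause, that the phase is not left in between, is what prevents an operation from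
choosing two tags. -/
theorem writer_getTag_history {τ : ℕ} {i : W} {op : ℕ} {v : Value k l F} {a : Call n l W F}
    (h : (β.cfg τ).writer i = .getTag op v a) :
    a.id = op ∧ ∃ T < τ, β.ev T = .invokeWrite i op v ∧
      β.Begun T (.writer i) op (n / 2 + 1) (fun _ => .queryTag) ∧
      ∀ σ, T < σ → σ ≤ τ → ∃ b, (β.cfg σ).writer i = .getTag op v b := by
  induction τ generalizing a with
  | zero =>
    rw [β.start] at h
    cases h
  | succ τ ih =>
    rcases (β.step τ).writer_getTag h with ⟨he, rfl⟩ | ⟨b, hb, hba⟩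
    · refine ⟨rfl, τ, τ.lt_succ_self, he, ⟨by rw [he]; rfl, ?_⟩, ?_⟩
      · exact Config.call?_writer_getTag h
      · intro σ h1 h2
        obtain rfl : σ = τ + 1 := by omega
        exact ⟨_, h⟩
    · obtain ⟨hid, T, hT, he, hB, hall⟩ := ih hb
      refine ⟨hba.id_eq.trans hid, T, hT.trans τ.lt_succ_self, he, hB, ?_⟩
      intro σ h1 h2
      rcases h2.lt_or_eq with h2 | rfl
      · exact hall σ h1 (by omega)
      · exact ⟨a, h⟩

theorem writer_putData_history {τ : ℕ} {i : W} {op : ℕ} {t : Tag W} {v : Value k l F}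
    {a : Call n l W F} (h : (β.cfg τ).writer i = .putData op t v a) :
    ∃ T < τ, β.ev T = .writePut i op t a.id ∧
      β.Begun T (.writer i) a.id ((3 * n + k) ⌈/⌉ 4) (codeElems P t v) := by
  induction τ generalizing a with
  | zero =>
    rw [β.start] at h
    cases h
  | succ τ ih =>
    rcases (β.step τ).writer_putData h with ⟨he, rfl⟩ | ⟨b, hb, hba⟩
    · refine ⟨τ, τ.lt_succ_self, he, by rw [he]; rfl, ?_⟩
      exact Config.call?_writer_putData h
    · obtain ⟨T, hT, he, hB⟩ := ih hb
      rw [hba.id_eq]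
      exact ⟨T, hT.trans τ.lt_succ_self, he, hB⟩

/-- The last clause says that once the awaited number of lists is reached, the lists no longer
change. The concurrency bound is stated for the first such time, decodability for every such time.
-/
theorem reader_getData_history {τ : ℕ} {i : R} {op : ℕ} {a : Call n l W F}
    (h : (β.cfg τ).reader i = .getData op a) :
    a.id = op ∧ ∃ T < τ, β.ev T = .invokeRead i op ∧
      β.Begun T (.reader i) op ((n + k) ⌈/⌉ 2) (fun _ => .queryList) ∧
      ∀ σ, T < σ → σ ≤ τ → ∃ b, (β.cfg σ).reader i = .getData op b ∧
        a.need = b.need ∧ (b.count = b.need → a.got = b.got) := by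
  induction τ generalizing a with
  | zero =>
    rw [β.start] at h
    cases h
  | succ τ ih =>
    rcases (β.step τ).reader_getData h with ⟨he, rfl⟩ | ⟨b, hb, hba⟩
    · refine ⟨rfl, τ, τ.lt_succ_self, he, ⟨by rw [he]; rfl, ?_⟩, ?_⟩
      · exact Config.call?_reader_getData h
      · intro σ h1 h2
        obtain rfl : σ = τ + 1 := by omega
        exact ⟨_, h, rfl, fun _ => rfl⟩
    · obtain ⟨hid, T, hT, he, hB, hall⟩ := ih hb
      refine ⟨hba.id_eq.trans hid, T, hT.trans τ.lt_succ_self, he, hB, ?_⟩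
      intro σ h1 h2
      rcases h2.lt_or_eq with h2 | rfl
      · obtain ⟨d, hd, hneed, hg⟩ := hall σ h1 (by omega)
        refine ⟨d, hd, hba.need_eq.trans hneed, fun hfull => ?_⟩
        rw [hba.got_eq_of_full, hg hfull]
        rw [Call.count_congr (hg hfull), hfull, hneed]
      · exact ⟨a, h, rfl, fun _ => rfl⟩

theorem reader_putData_history {τ : ℕ} {i : R} {op : ℕ} {t : Tag W} {v : Value k l F}
    {a : Call n l W F} (h : (β.cfg τ).reader i = .putData op t v a) :
    ∃ T < τ, β.ev T = .readPut i op t v a.id ∧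
      β.Begun T (.reader i) a.id ((3 * n + k) ⌈/⌉ 4) (codeElems P t v) := by
  induction τ generalizing a with
  | zero =>
    rw [β.start] at h
    cases h
  | succ τ ih =>
    rcases (β.step τ).reader_putData h with ⟨he, rfl⟩ | ⟨b, hb, hba⟩
    · refine ⟨τ, τ.lt_succ_self, he, by rw [he]; rfl, ?_⟩
      exact Config.call?_reader_putData h
    · obtain ⟨T, hT, he, hB⟩ := ih hb
      rw [hba.id_eq]
      exact ⟨T, hT.trans τ.lt_succ_self, he, hB⟩

/-- The interval of inactivity includes `T` itself, since the server is still crashed in the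
configuration before the repair event. -/
theorem server_repair_history {τ : ℕ} {i : Fin n} {op : ℕ} {a : Call n l W F}
    (h : (β.cfg τ).server i = .repair op a) :
    a.id = op ∧ ∃ T < τ, β.Begun T (.server i) op ((n + k) ⌈/⌉ 2) (fun _ => .repairList) ∧
      ∀ σ, T ≤ σ → σ ≤ τ → ¬ ((β.cfg σ).server i).IsActive := by
  induction τ generalizing a with
  | zero =>
    rw [β.start] at h
    cases h
  | succ τ ih =>
    have hna : ¬ ((β.cfg (τ + 1)).server i).IsActive := by
      rintro ⟨L, hL⟩
      rw [hL] at h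
      cases h
    rcases (β.step τ).server_repair h with ⟨he, hc, rfl⟩ | ⟨b, hb, hba⟩
    · refine ⟨rfl, τ, τ.lt_succ_self, ⟨by rw [he]; rfl, ?_⟩, ?_⟩
      · exact Config.call?_server_repair h
      · intro σ h1 h2
        rcases h2.lt_or_eq with h2 | rfl
        · obtain rfl : σ = τ := by omega
          rintro ⟨L, hL⟩
          rw [hL] at hc
          cases hc
        · exact hna
    · obtain ⟨hid, T, hT, hB, hall⟩ := ih hb
      refine ⟨hba.id_eq.trans hid, T, hT.trans τ.lt_succ_self, hB, ?_⟩
      intro σ h1 h2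
      rcases h2.lt_or_eq with h2 | rfl
      · exact hall σ h1 (by omega)
      · exact hna

end Execution

end Histories

/-! ### Server lists: pruning, highest tag, replies. -/

section Lists

variable {n k l : ℕ} {W R F : Type*} [LinearOrder W]

theorem mem_of_mem_prune {d : ℕ} {L : VList l W F} {x : Tag W × Coded l F}
    (h : x ∈ prune d L) : x ∈ L := by
  unfold prune at h
  split at h
  · exact (Finset.mem_filter.1 h).1
  · exact h

/-- `prune` counts distinct tags above a pair, not pairs, so only the number of higher tags matters.
-/
theorem mem_prune {d : ℕ} {L : VList l W F} {x : Tag W × Coded l F} (hx : x ∈ L)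
    (hd : ((L.image Prod.fst).filter fun t => x.1 < t).card ≤ d) : x ∈ prune d L := by
  unfold prune
  split
  · exact Finset.mem_filter.2 ⟨hx, Nat.lt_succ_of_le hd⟩
  · exact hx

theorem maxTag_cases (t0 : Tag W) (L : VList l W F) :
    maxTag t0 L = t0 ∨ ∃ x, (maxTag t0 L, x) ∈ L := by
  unfold maxTag
  cases h : (L.image Prod.fst).max with
  | bot => exact .inl rfl
  | coe t =>
    obtain ⟨⟨s, x⟩, hs, rfl⟩ := Finset.mem_image.1 (Finset.mem_of_max h)
    exact .inr ⟨x, hs⟩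

theorem serve_resp_list {P : System n k l W F} {L L' : VList l W F} {b : Req l W F}
    (h : Resp.list L' = (serve P L b).2) : L' = L := by
  cases b <;> simp [serve] at h <;> exact h

theorem serve_resp_tag {P : System n k l W F} {L : VList l W F} {b : Req l W F} {t : Tag W}
    (h : Resp.tag t = (serve P L b).2) : t = maxTag P.t0 L := by
  cases b <;> simp [serve] at h
  exact h

theorem mem_serve {P : System n k l W F} {L : VList l W F} {b : Req l W F} {t : Tag W}
    {x : Coded l F} (h : (t, x) ∈ (serve P L b).1) : (t, x) ∈ L ∨ b = .codeElem t x := by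
  cases b with
  | codeElem s y =>
    rcases Finset.mem_insert.1 (mem_of_mem_prune h) with h | h
    · cases h
      exact .inr rfl
    · exact .inl h
  | _ => exact .inl h

end Lists

/-- New tags enter the system only through `writePut`; a reader writes back a tag that it has
decoded. -/
theorem Step.groupSend_codeElem {n k l : ℕ} {W R F : Type*} [LinearOrder W] [Field F]
    {P : System n k l W F} {c c' : Config n k l W R F} {e : Event n k l W R F}
    (h : Step P c e c') {p : Proc n W R} {id : ℕ} {a : Call n l W F}
    (he : e.groupSend? = some (p, id)) (ha : c'.call? p = some a) {i : Fin n} {t : Tag W}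
    {x : Coded l F} (hm : a.msg i = .codeElem t x) :
    (∃ w op, e = .writePut w op t id) ∨
      ∃ r op b v, c.reader r = .getData op b ∧ Decodable P.gen b.got t v := by
  cases h <;> simp only [Event.groupSend?, Option.some.injEq, Prod.mk.injEq, reduceCtorEq] at he
  all_goals
    obtain ⟨rfl, rfl⟩ := he
    simp only [Config.call?, Config.tick, Config.setWriter, Config.setReader, Config.setServer,
      Function.update_self, WriterState.call?, ReaderState.call?, ServerState.call?,
      Option.some.injEq] at ha
    subst ha
    simp only [Call.start, codeElems, Req.codeElem.injEq, reduceCtorEq] at hm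
  · exact .inl ⟨_, _, by rw [hm.1]⟩
  · next r op b t' v' h ha hdec hmax => exact .inr ⟨r, op, b, v', h, hm.1 ▸ hdec⟩

namespace Execution

variable {n k l : ℕ} {W R F : Type*} [LinearOrder W] [Field F] {P : System n k l W F}
  {β : Execution R P}

/-! ### The tags in the system -/

variable (β) in
/-- The tag `t` is the initial tag or the tag of a write that has chosen it before time `τ`. -/
def Known (τ : ℕ) (t : Tag W) : Prop :=
  t = P.t0 ∨ ∃ σ < τ, ∃ i op id, β.ev σ = .writePut i op t id

theorem Known.mono {τ τ' : ℕ} {t : Tag W} (h : β.Known τ t) (hτ : τ ≤ τ') : β.Known τ' t := by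
  rcases h with h | ⟨σ, hσ, h⟩
  · exact .inl h
  · exact .inr ⟨σ, hσ.trans_le hτ, h⟩

/-- As `k ≥ 1`, at least one list contains the tag, and an active server held that list at an
earlier time. -/
theorem Decodable.source {τ : ℕ} {p : Proc n W R} {a : Call n l W F} (hk : 1 ≤ k)
    (ha : (β.cfg τ).call? p = some a) {t : Tag W} {v : Value k l F}
    (hd : Decodable P.gen a.got t v) :
    ∃ σ < τ, ∃ i L x, (β.cfg σ).server i = .active L ∧ (t, x) ∈ L := by
  obtain ⟨S, hS, h⟩ := hd
  obtain ⟨i, hi⟩ : S.Nonempty := Finset.card_pos.1 (by omega)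
  obtain ⟨L, hL, hmem⟩ := h i hi
  obtain ⟨T, -, hB⟩ := call_begun ha
  obtain ⟨σ, -, hσ, L', hL', -, hr⟩ := got_answered ha hB hL
  exact ⟨σ, hσ, i, L', _, hL', serve_resp_list hr ▸ hmem⟩

/-- The induction must be strong: a tag arriving through a read's write-back or a repair is traced
to a list held by some other server at an arbitrary earlier time. -/
theorem list_tag_known (hk : 1 ≤ k) {τ : ℕ} : ∀ {i : Fin n} {L : VList l W F} {t : Tag W}
    {x : Coded l F}, (β.cfg τ).server i = .active L → (t, x) ∈ L → β.Known τ t := by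
  induction τ using Nat.strong_induction_on with
  | _ τ ih =>
  intro i L t x hL hx
  cases τ with
  | zero =>
    rw [β.start] at hL
    simp only [Config.init, ServerState.active.injEq] at hL
    subst hL
    rw [Finset.mem_singleton, Prod.mk.injEq] at hx
    exact .inl hx.1
  | succ τ =>
    rcases (β.step τ).server_active hL with h | ⟨m, L', hm, -, hL', rfl⟩ |
      ⟨op, a, D, hr, -, hD, rfl⟩
    · exact (ih τ τ.lt_succ_self h hx).mono τ.le_succ
    · rcases mem_serve hx with hx | hb
      · exact (ih τ τ.lt_succ_self hL' hx).mono τ.le_succ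
      · obtain ⟨T, hT, need, msg, hB, hbody⟩ := req_begun hm
        rcases (β.step T).groupSend_codeElem hB.1 hB.2 (hbody.symm.trans hb) with
          ⟨w, op, he⟩ | ⟨r, op, a, v, hr, hd⟩
        · exact .inr ⟨T, by omega, w, op, _, he⟩
        · obtain ⟨σ, hσ, j, L, y, hL, hy⟩ := Decodable.source hk
            (Config.call?_reader_getData hr) hd
          exact (ih σ (by omega) hL hy).mono (by omega)
    · obtain ⟨v, hd, -⟩ := (hD t x).1 (mem_of_mem_prune hx)
      obtain ⟨σ, hσ, j, L, y, hL, hy⟩ := Decodable.source hk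
        (Config.call?_server_repair hr) hd
      exact (ih σ (by omega) hL hy).mono (by omega)

theorem writePut_state {τ : ℕ} {i : W} {op : ℕ} {t : Tag W} {id : ℕ}
    (he : β.ev τ = .writePut i op t id) :
    ∃ v a b s t', (β.cfg τ).writer i = .getTag op v a ∧
      (β.cfg (τ + 1)).writer i = .putData op t v b ∧ a.got s = some (.tag t') ∧
      t = toLex ((ofLex t').1 + 1, i) := by
  have h := β.step τ
  rw [he] at h
  generalize β.cfg (τ + 1) = c' at h ⊢
  cases h with
  | writePut _ _ v a t h _ ht =>
    obtain ⟨s, hs⟩ := ht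
    refine ⟨v, a, Call.start (β.cfg τ).fresh ((3 * n + k) ⌈/⌉ 4)
      (codeElems P (toLex ((ofLex t).1 + 1, i)) v), s, t, h, ?_, hs, rfl⟩
    simp only [Config.tick, Config.setWriter, Function.update_self]

/-- Every queried tag is at least `t0`, being `t0` itself or, by induction, the tag of an earlier
write; incrementing the integer part makes the new tag strictly larger. -/
theorem initial_lt_write_tag (hk : 1 ≤ k) {τ : ℕ} : ∀ {i : W} {op : ℕ} {t : Tag W} {id : ℕ},
    β.ev τ = .writePut i op t id → P.t0 < t := by
  induction τ using Nat.strong_induction_on with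
  | _ τ ih =>
  intro i op t id he
  obtain ⟨v, a, -, s, t', hg, -, hs, rfl⟩ := writePut_state he
  have hc := Config.call?_writer_getTag hg
  obtain ⟨T, -, hB⟩ := call_begun hc
  obtain ⟨σ, -, hσ, L, hL, -, hr⟩ := got_answered hc hB hs
  have hle : P.t0 ≤ t' := by
    rw [serve_resp_tag hr]
    -- A repaired server may have an empty list; the default `t0` of `maxTag` covers it.
    rcases maxTag_cases P.t0 L with h | ⟨x, hx⟩
    · exact h.ge
    · rcases list_tag_known hk hL hx with h | ⟨ρ, hρ, _, _, _, he'⟩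
      · exact h.ge
      · exact (ih ρ (hρ.trans hσ) he').le
  rw [Prod.Lex.lt_iff]
  left
  have := (Prod.Lex.le_iff.1 hle)
  simp only [ofLex_toLex]
  omega

/-- After the first choice the writer is in its put-data phase, whereas a second choice would
require it to have been in the get-tag phase ever since the invocation. -/
theorem HasTag.unique {op : ℕ} {t t' : Tag W} (h : β.HasTag op t) (h' : β.HasTag op t') :
    t = t' := by
  have key : ∀ {σ σ' i i' t t' id id'}, β.ev σ = .writePut i op t id →
      β.ev σ' = .writePut i' op t' id' → ¬ σ < σ' := by
    intro σ σ' i i' t t' id id' he he' hlt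
    obtain ⟨v, a, b, -, -, hs, hs1, -⟩ := writePut_state he
    obtain ⟨v', a', -, -, -, hs', -⟩ := writePut_state he'
    obtain ⟨-, T, hT, -, hB, -⟩ := writer_getTag_history hs
    obtain ⟨-, T', hT', -, hB', hall⟩ := writer_getTag_history hs'
    obtain ⟨rfl, hp, -⟩ := hB.unique hB'
    cases hp
    obtain ⟨d, hd⟩ := hall (σ + 1) (by omega) hlt
    rw [hs1] at hd
    cases hd
  obtain ⟨σ, i, id, he⟩ := h
  obtain ⟨σ', i', id', he'⟩ := h'
  obtain rfl : σ = σ' := le_antisymm (not_lt.1 (key he' he)) (not_lt.1 (key he he'))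
  rw [he] at he'
  cases he'
  rfl

/-- The number of tags above `t` in the system is at most the number of concurrent writes. -/
theorem card_known_le {T₁ T₂ d : ℕ} {t : Tag W} (hd : (β.concurrentWrites T₁ T₂).encard ≤ d)
    (h0 : P.t0 ≤ t)
    (ht : ∀ op t', β.WriteCompletesBefore op T₁ → β.HasTag op t' → t' ≤ t)
    (K : Finset (Tag W)) (hK : ∀ s ∈ K, β.Known T₂ s ∧ t < s) : K.card ≤ d := by
  have hop : ∀ s ∈ K, ∃ op ∈ β.concurrentWrites T₁ T₂, β.HasTag op s := by
    intro s hs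
    obtain ⟨hs, hlt⟩ := hK s hs
    rcases hs with rfl | ⟨σ, hσ, i, op, id, he⟩
    -- The initial tag belongs to no write, but it is not above `t`.
    · exact absurd hlt h0.not_gt
    · obtain ⟨v, a, -, -, -, hg, -⟩ := writePut_state he
      obtain ⟨-, T, hT, heT, -⟩ := writer_getTag_history hg
      have hs : β.HasTag op s := ⟨σ, i, id, he⟩
      exact ⟨op, ⟨⟨T, hT.trans hσ, i, v, heT⟩, s, hs,
        fun op' t' hc hh => (ht op' t' hc hh).trans_lt hlt⟩, hs⟩
  choose! f hf using hop
  -- A write has only one tag, so different tags come from different writes.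
  have hinj : Set.InjOn f K := by
    intro s hs s' hs' hss
    refine (hf s hs).2.unique ?_
    rw [hss]
    exact (hf s' hs').2
  have hsub : ((K.image f : Finset ℕ) : Set ℕ) ⊆ β.concurrentWrites T₁ T₂ := by
    intro op hop
    obtain ⟨s, hs, rfl⟩ := Finset.mem_image.1 (Finset.mem_coe.1 hop)
    exact (hf s hs).1
  have := (Set.encard_le_encard hsub).trans hd
  rw [Set.encard_coe_eq_coe_finsetCard, Finset.card_image_of_injOn hinj] at this
  exact_mod_cast this

/-! ### Persistence of a version -/

/-- A pair is not pruned if few tags above its own are known. -/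
theorem mem_prune_of_known {H : ℕ} {t : Tag W}
    (hne : ∀ K : Finset (Tag W), (∀ s ∈ K, β.Known H s ∧ t < s) → K.card ≤ P.delta)
    {L : VList l W F} {x : Coded l F} (hx : (t, x) ∈ L)
    (hL : ∀ s y, (s, y) ∈ L → β.Known H s) : (t, x) ∈ prune P.delta L := by
  refine mem_prune hx (hne _ fun s hs => ?_)
  obtain ⟨hs, hlt⟩ := Finset.mem_filter.1 hs
  obtain ⟨⟨s, y⟩, hy, rfl⟩ := Finset.mem_image.1 hs
  exact ⟨hL s y hy, hlt⟩

theorem insert_known (hk : 1 ≤ k) {τ H : ℕ} (hτ : τ ≤ H) {m : ReqMsg n l W R F}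
    (hm : m ∈ (β.cfg τ).reqs) {L : VList l W F} {i : Fin n}
    (hL : (β.cfg τ).server i = .active L) {t : Tag W} {x : Coded l F}
    (hb : m.body = .codeElem t x) :
    ∀ s y, (s, y) ∈ insert (t, x) L → β.Known H s := by
  intro s y hy
  rcases Finset.mem_insert.1 hy with h | h
  · cases h
    obtain ⟨T, hT, need, msg, hB, hbody⟩ := req_begun hm
    rcases (β.step T).groupSend_codeElem hB.1 hB.2 (hbody.symm.trans hb) with
      ⟨w, op, he⟩ | ⟨r, op, a, v, hr, hd⟩
    · exact .inr ⟨T, by omega, w, op, _, he⟩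
    · obtain ⟨σ, hσ, j, L, y, hL, hy⟩ := Decodable.source hk
        (Config.call?_reader_getData hr) hd
      exact (list_tag_known hk hL hy).mono (by omega)
  · exact (list_tag_known hk hL h).mono hτ

/-- If all responses of the servers in `G` to a list query contain the version `(t, v)`, it can be
decoded. -/
theorem decodable_of_full {τ T need : ℕ} {p : Proc n W R} {a : Call n l W F}
    {msg : Fin n → Req l W F} (ha : (β.cfg τ).call? p = some a)
    (hB : β.Begun T p a.id need msg) (hmsg : ∀ i L, (serve P L (msg i)).2 = .list L)
    (hfull : a.count = a.need) {G : Finset (Fin n)}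
    (hG : ∀ Q : Finset (Fin n), need ≤ Q.card → k ≤ (Q ∩ G).card)
    {t : Tag W} {v : Value k l F}
    (hmem : ∀ σ, T < σ → σ < τ → ∀ j ∈ G, ∀ L, (β.cfg σ).server j = .active L →
      (t, encode P.gen v j) ∈ L) : Decodable P.gen a.got t v := by
  obtain ⟨T', -, hB'⟩ := call_begun ha
  obtain ⟨rfl, -, rfl, rfl⟩ := hB.unique hB'
  obtain ⟨S, hS, hcard⟩ := Finset.exists_subset_card_eq (hG _ hfull.ge)
  refine ⟨S, hcard, fun i hi => ?_⟩
  obtain ⟨hi, hiG⟩ := Finset.mem_inter.1 (hS hi)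
  obtain ⟨r, hr⟩ := Option.isSome_iff_exists.1 (Finset.mem_filter.1 hi).2
  obtain ⟨σ, h1, h2, L, hL, -, hrL⟩ := got_answered ha hB hr
  exact ⟨L, by rw [hr, hrL, hmsg], hmem σ h1 h2 i hiG L hL⟩

/-- If the servers in a large set `G` are active from the time they store the version `(t, v)`
until a common time `B`, then from then on they store it whenever they are active: a server of `G`
that crashes is repaired after `B`, with the help of the other servers in `G`. -/
theorem version_persists (hk : 1 ≤ k) {t : Tag W} {v : Value k l F} {G : Finset (Fin n)}
    {q : Fin n → ℕ} {B H : ℕ}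
    (hG : ∀ Q : Finset (Fin n), (n + k) ⌈/⌉ 2 ≤ Q.card → k ≤ (Q ∩ G).card)
    (hq : ∀ j ∈ G, q j ≤ B)
    (hact : ∀ j ∈ G, ∀ σ, q j ≤ σ → σ ≤ B → ((β.cfg σ).server j).IsActive)
    (hin : ∀ j ∈ G, ∀ L, (β.cfg (q j)).server j = .active L → (t, encode P.gen v j) ∈ L)
    (hne : ∀ K : Finset (Tag W), (∀ s ∈ K, β.Known H s ∧ t < s) → K.card ≤ P.delta)
    {τ : ℕ} (hτ : τ ≤ H) {j : Fin n} (hj : j ∈ G) (hqj : q j ≤ τ) {L : VList l W F}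
    (hL : (β.cfg τ).server j = .active L) : (t, encode P.gen v j) ∈ L := by
  induction τ using Nat.strong_induction_on generalizing j L with
  | _ τ ih =>
  rcases hqj.eq_or_lt with rfl | hlt
  · exact hin j hj L hL
  obtain ⟨τ, rfl⟩ : ∃ σ, τ = σ + 1 := ⟨τ - 1, by omega⟩
  have hqτ : q j ≤ τ := Nat.le_of_lt_succ hlt
  rcases (β.step τ).server_active hL with h | ⟨m, L', hm, -, hL', rfl⟩ |
    ⟨op, a, D, hr, ha, hD, rfl⟩
  · exact ih τ τ.lt_succ_self (by omega) hj hqτ h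
  · have hmem := ih τ τ.lt_succ_self (by omega) hj hqτ hL'
    cases hb : m.body with
    | codeElem s x =>
      exact mem_prune_of_known hne (Finset.mem_insert_of_mem hmem)
        (insert_known hk (by omega) hm hL' hb)
    | _ => exact hmem
  · have hc : (β.cfg τ).call? (.server j) = some a :=
      Config.call?_server_repair hr
    obtain ⟨rfl, T, hT, hB, hna⟩ := server_repair_history hr
    -- If the repair started at `T ≤ B`, the server would be both inactive and active at time `max T
    -- (q j)`.
    have hBT : B < T := by
      by_contra hcon
      rcases le_total (q j) T with h | h
      · exact hna T le_rfl hT.le (hact j hj T h (not_lt.1 hcon))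
      · exact hna (q j) h hqτ (hact j hj (q j) le_rfl (hq j hj))
    -- The lists were sent after `T > B ≥ q i`, so the induction hypothesis applies to every server
    -- `i` of `G` that contributed one.
    have hdec : Decodable P.gen a.got t v := by
      refine decodable_of_full hc hB (fun _ _ => rfl) ha.2 hG ?_
      intro σ h1 h2 i hi L hL
      exact ih σ (by omega) (by omega) hi ((hq i hi).trans (by omega)) hL
    refine mem_prune_of_known hne ((hD _ _).2 ⟨v, hdec, rfl⟩) ?_
    intro s y hy
    obtain ⟨v', hd, -⟩ := (hD s y).1 hy
    obtain ⟨σ, hσ, i, L, y, hL, hy⟩ := Decodable.source hk hc hd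
    exact (list_tag_known hk hL hy).mono (by omega)

end Execution

namespace Execution

variable {n k l : ℕ} {W R F : Type*} [LinearOrder W] [Field F] {P : System n k l W F}
  {β : Execution R P}

/-! ### Consequences of network stability -/

theorem recvReq_active {τ : ℕ} {m : ReqMsg n l W R F} (he : β.ev τ = .recvReq m)
    (hact : ((β.cfg τ).server m.dst).IsActive) :
    ∃ L, (β.cfg τ).server m.dst = .active L ∧
      (β.cfg (τ + 1)).server m.dst = .active (serve P L m.body).1 ∧
      ⟨m.id, m.dst, m.src, (serve P L m.body).2⟩ ∈ (β.cfg (τ + 1)).resps := by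
  have h := β.step τ
  rw [he] at h
  generalize β.cfg (τ + 1) = c' at h ⊢
  cases h with
  | recvReq _ L hm h => exact ⟨L, h, Function.update_self m.dst _ _, .inl rfl⟩
  | loseReq _ hm h => exact absurd hact h

theorem recvReq_mem {τ : ℕ} {m : ReqMsg n l W R F} (he : β.ev τ = .recvReq m) :
    m ∈ (β.cfg τ).reqs := by
  have h := β.step τ
  rw [he] at h
  generalize β.cfg (τ + 1) = c' at h
  cases h with
  | recvReq _ L hm h => exact hm
  | loseReq _ hm h => exact hm

/-- In terms of the effects on the servers, condition `N1` for a call with all messages sent. -/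
theorem N1.answers {α : ℝ} (hN : β.N1 α) {τ T need : ℕ} {p : Proc n W R} {a : Call n l W F}
    {msg : Fin n → Req l W F} (ha : (β.cfg τ).call? p = some a)
    (hB : β.Begun T p a.id need msg) (hsent : a.unsent = ∅) :
    ∃ (S : Finset (Fin n)) (B : ℕ), S.card = ⌈α * n⌉₊ ∧
      (∀ i ∈ S, ∀ σ, T ≤ σ → σ ≤ B → ((β.cfg σ).server i).IsActive) ∧
      ∀ i ∈ S, ∃ σ, T < σ ∧ σ < B ∧ ∃ L, (β.cfg σ).server i = .active L ∧
        (β.cfg (σ + 1)).server i = .active (serve P L (msg i)).1 ∧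
        ⟨a.id, i, p, (serve P L (msg i)).2⟩ ∈ (β.cfg (σ + 1)).resps := by
  obtain ⟨S, B, hS, -, hrecv, hact⟩ := hN p a.id T hB.1
    fun i => call_sent ha (by simp [hsent])
  refine ⟨S, B, hS, hact, fun i hi => ?_⟩
  obtain ⟨σ, hσ, m, he, hid, rfl⟩ := hrecv i hi
  obtain ⟨T', hT', need', msg', hB', hbody⟩ := req_begun (recvReq_mem he)
  rw [hid] at hB'
  obtain ⟨rfl, hp, -, rfl⟩ := hB.unique hB'
  -- Activity up to `B` guarantees that the message is served and not lost.
  obtain ⟨L, h1, h2, h3⟩ := recvReq_active he (hact m.dst hi σ hT'.le hσ.le)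
  rw [hbody] at h2 h3
  rw [hid, ← hp] at h3
  exact ⟨σ, hT', hσ, L, h1, h2, h3⟩

theorem writeDone_state {τ : ℕ} {i : W} {op : ℕ} (he : β.ev τ = .writeDone i op) :
    ∃ t v a, (β.cfg τ).writer i = .putData op t v a ∧ a.Complete := by
  have h := β.step τ
  rw [he] at h
  generalize β.cfg (τ + 1) = c' at h
  cases h with
  | writeDone _ _ t v a h ha => exact ⟨t, v, a, h, ha⟩

theorem le_card_inter {G Q : Finset (Fin n)} {s r m : ℕ} (hG : s ≤ G.card) (hQ : r ≤ Q.card)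
    (h : n + m ≤ s + r) : m ≤ (Q ∩ G).card := by
  have h1 := Finset.card_union_add_card_inter Q G
  have h2 := Finset.card_le_univ (Q ∪ G)
  rw [Fintype.card_fin] at h2
  omega

/-- The version of a write that completes is stored at `⌈(n + k) / 2⌉` servers, before the write
completes, and each of them remains active until all of them have stored it. -/
theorem written_quorum {α : ℝ} (hN : β.N1 α) (hα : (3 * n + k) ⌈/⌉ 4 ≤ ⌈α * n⌉₊) (hk : 1 ≤ k)
    {τ : ℕ} {i : W} {op : ℕ} (he : β.ev τ = .writeDone i op) :
    ∃ (t : Tag W) (v : Value k l F) (G : Finset (Fin n)) (q : Fin n → ℕ) (B : ℕ),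
      β.HasTag op t ∧ (n + k) ⌈/⌉ 2 ≤ G.card ∧ (∀ j ∈ G, q j ≤ τ) ∧ (∀ j ∈ G, q j ≤ B) ∧
      (∀ j ∈ G, ∀ σ, q j ≤ σ → σ ≤ B → ((β.cfg σ).server j).IsActive) ∧
      ∀ j ∈ G, ∃ L : VList l W F, (β.cfg (q j)).server j = .active (prune P.delta L) ∧
        (t, encode P.gen v j) ∈ L ∧ ∀ s y, (s, y) ∈ L → β.Known (q j) s := by
  obtain ⟨t, v, a, hs, ha⟩ := writeDone_state he
  have hc := Config.call?_writer_putData hs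
  obtain ⟨T, hT, heT, hB⟩ := writer_putData_history hs
  obtain ⟨T', -, hB'⟩ := call_begun hc
  have hneed := (hB.unique hB').2.2.1
  obtain ⟨S, B, hS, hact, hans⟩ := hN.answers hc hB ha.1
  let A := Finset.univ.filter fun i => (a.got i).isSome
  have hA : A.card = (3 * n + k) ⌈/⌉ 4 := ha.2.trans hneed.symm
  -- `N1` gives a storing event before `B`, the acknowledgement one before `τ`. The earlier of the
  -- two satisfies both bounds, so they need not be identified.
  have hstore : ∀ j ∈ S ∩ A, ∃ σ, T < σ ∧ σ < B ∧ σ < τ ∧ ∃ L, (β.cfg σ).server j = .active L ∧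
      (β.cfg (σ + 1)).server j =
        .active (prune P.delta (insert (t, encode P.gen v j) L)) := by
    intro j hj
    obtain ⟨hjS, hjA⟩ := Finset.mem_inter.1 hj
    obtain ⟨σ, h1, h2, L, hL, hL', -⟩ := hans j hjS
    obtain ⟨r, hr⟩ := Option.isSome_iff_exists.1 (Finset.mem_filter.1 hjA).2
    obtain ⟨ρ, h3, h4, M, hM, hM', -⟩ := got_answered hc hB hr
    rcases lt_or_ge σ ρ with h | h
    · exact ⟨σ, h1, h2, h.trans h4, L, hL, hL'⟩
    · exact ⟨ρ, h3, h.trans_lt h2, h4, M, hM, hM'⟩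
  choose! q h1 h2 h3 L hL hL' using hstore
  -- The effect of the storing event `q j` is visible in configuration `q j + 1`.
  refine ⟨t, v, S ∩ A, fun j => q j + 1, B, ⟨T, i, _, heT⟩, ?_, h3, h2, ?_, ?_⟩
  -- `2⌈(3n+k)/4⌉ ≥ ⌈(3n+k)/2⌉ = n + ⌈(n+k)/2⌉`.
  · refine le_card_inter (s := (3 * n + k) ⌈/⌉ 4) (r := (3 * n + k) ⌈/⌉ 4) hA.ge
      (hα.trans hS.ge) ?_
    simp only [Nat.ceilDiv_eq_add_pred_div]
    omega
  · intro j hj σ hσ hσB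
    dsimp only at hσ
    have := h1 j hj
    exact hact j (Finset.mem_inter.1 hj).1 σ (by omega) hσB
  · intro j hj
    dsimp only
    refine ⟨_, hL' j hj, Finset.mem_insert_self _ _, ?_⟩
    intro s y hy
    rcases Finset.mem_insert.1 hy with h | h
    · cases h
      have := h1 j hj
      exact .inr ⟨T, by omega, i, op, _, heT⟩
    · exact (list_tag_known hk (hL j hj) h).mono (by omega)

/-- Needed to pick the highest completed tag: an event completes at most one write, and a write has
at most one tag. -/
theorem finite_completed_tags (T : ℕ) :
    {t | ∃ op, β.WriteCompletesBefore op T ∧ β.HasTag op t}.Finite := by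
  have h1 : {op | β.WriteCompletesBefore op T}.Finite := by
    refine ((Set.finite_Iio T).biUnion (t := fun σ => {op | ∃ i, β.ev σ = .writeDone i op})
      fun σ _ => Set.Subsingleton.finite ?_).subset ?_
    · rintro op ⟨i, h⟩ op' ⟨i', h'⟩
      rw [h] at h'
      cases h'
      rfl
    · rintro op ⟨σ, hσ, i, h⟩
      exact Set.mem_biUnion (Set.mem_Iio.2 hσ) ⟨i, h⟩
  refine (h1.biUnion (t := fun op => {t | β.HasTag op t})
    fun op _ => Set.Subsingleton.finite fun t ht t' ht' => HasTag.unique ht ht').subset ?_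
  rintro t ⟨op, hop, ht⟩
  exact Set.mem_biUnion hop ht

/-! ### Decodability -/

/-- Some version is stored, throughout the interval, at every active server of a set that has `k`
servers in common with any `⌈(n + k) / 2⌉` servers. -/
theorem exists_stored_version {α : ℝ} (hN : β.N1 α) (hα : (3 * n + k) ⌈/⌉ 4 ≤ ⌈α * n⌉₊)
    (hk : 1 ≤ k) {T₁ T₂ : ℕ} (hT : T₁ ≤ T₂)
    (hd : (β.concurrentWrites T₁ T₂).encard ≤ P.delta) :
    ∃ (t : Tag W) (v : Value k l F) (G : Finset (Fin n)),
      (∀ Q : Finset (Fin n), (n + k) ⌈/⌉ 2 ≤ Q.card → k ≤ (Q ∩ G).card) ∧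
      ∀ σ, T₁ ≤ σ → σ ≤ T₂ → ∀ j ∈ G, ∀ L, (β.cfg σ).server j = .active L →
        (t, encode P.gen v j) ∈ L := by
  have hinter : ∀ G : Finset (Fin n), (n + k) ⌈/⌉ 2 ≤ G.card →
      ∀ Q : Finset (Fin n), (n + k) ⌈/⌉ 2 ≤ Q.card → k ≤ (Q ∩ G).card := by
    intro G hG Q hQ
    refine le_card_inter hG hQ ?_
    simp only [Nat.ceilDiv_eq_add_pred_div]
    omega
  by_cases hX : {t | ∃ op, β.WriteCompletesBefore op T₁ ∧ β.HasTag op t}.Nonempty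
  · obtain ⟨t, ⟨op, ⟨τ, hτ, i, he⟩, htag⟩, hmax⟩ :=
      Set.exists_max_image _ id (finite_completed_tags T₁) hX
    obtain ⟨t', v, G, q, B, htag', hcard, hqτ, hqB, hact, hst⟩ := written_quorum hN hα hk he
    obtain rfl := htag.unique htag'
    have h0 : P.t0 ≤ t := by
      obtain ⟨_, _, _, h⟩ := htag
      exact (initial_lt_write_tag hk h).le
    -- By maximality of `t`, a write with a higher tag exceeds all completed ones. The bound on tags
    -- known by `T₂` also covers every earlier pruning, because `Known` is monotone in time.
    have hne := card_known_le hd h0 fun op t' h h' => hmax t' ⟨op, h, h'⟩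
    refine ⟨t, v, G, hinter G hcard, fun σ h1 h2 j hj L hL => ?_⟩
    refine version_persists hk (hinter G hcard) hqB hact ?_ hne h2 hj
      ((hqτ j hj).trans (by omega)) hL
    intro j hj L hL
    obtain ⟨M, hM, hmem, hknown⟩ := hst j hj
    rw [hM] at hL
    cases hL
    exact mem_prune_of_known hne hmem fun s y hy =>
      (hknown s y hy).mono ((hqτ j hj).trans (hτ.le.trans hT))
  · have hne := card_known_le hd le_rfl fun op t' h h' => (hX ⟨t', op, h, h'⟩).elim
    have hG : ∀ Q : Finset (Fin n), (n + k) ⌈/⌉ 2 ≤ Q.card →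
        k ≤ (Q ∩ Finset.univ).card := by
      intro Q hQ
      have h := Finset.card_le_univ Q
      rw [Fintype.card_fin] at h
      rw [Finset.inter_univ]
      simp only [Nat.ceilDiv_eq_add_pred_div] at hQ
      omega
    -- No write has completed: the initial version is at all servers at time `0`, so `q = B = 0` and
    -- activity is needed only in the initial configuration.
    refine ⟨P.t0, P.v0, Finset.univ, hG, fun σ h1 h2 j hj L hL => ?_⟩
    refine version_persists (q := fun _ => 0) (B := 0) hk hG (fun _ _ => le_rfl) ?_ ?_ hne h2 hj
      (Nat.zero_le _) hL
    · intro j _ σ _ hσ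
      obtain rfl := Nat.le_zero.1 hσ
      rw [β.start]
      exact ⟨_, rfl⟩
    · intro j _ L hL
      rw [β.start] at hL
      cases hL
      exact Finset.mem_singleton_self _

theorem HasLists.decodable {α : ℝ} (hN : β.N1 α) (hα : (3 * n + k) ⌈/⌉ 4 ≤ ⌈α * n⌉₊)
    (hk : 1 ≤ k) (hδ : β.ConcurrencyAtMost P.delta) {r : R} {op T : ℕ} {a : Call n l W F}
    (h : β.HasLists r op a T) : ∃ t v, Decodable P.gen a.got t v := by
  have hex : ∃ T, ∃ a, β.HasLists r op a T := ⟨T, a, h⟩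
  have hleast : IsLeast {T | ∃ a, β.HasLists r op a T} (Nat.find hex) :=
    ⟨Nat.find_spec hex, fun _ hT => Nat.find_min' hex hT⟩
  generalize Nat.find hex = T₂ at hleast
  obtain ⟨-, T₁, -, he, hB, hall⟩ := reader_getData_history h.1
  obtain ⟨b, hb, hfull⟩ := hleast.1
  obtain ⟨hid, T₁', hT₁, -, hB', -⟩ := reader_getData_history hb
  obtain ⟨rfl, -⟩ := hB.unique hB'
  obtain ⟨b', hb', -, hgot⟩ := hall T₂ hT₁ (hleast.2 ⟨a, h⟩)
  rw [hb] at hb'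
  cases hb'
  obtain ⟨t, v, G, hG, hmem⟩ := exists_stored_version hN hα hk hT₁.le (hδ.1 r op T₁ T₂ he hleast)
  refine ⟨t, v, ?_⟩
  -- The lists at `T` are those at the first time `T₂`.
  rw [hgot hfull]
  exact decodable_of_full (Config.call?_reader_getData hb) (hid.symm ▸ hB) (fun _ _ => rfl) hfull
    hG fun σ h1 h2 => hmem σ h1.le h2.le

end Execution

/-- A local step of a process whose call is complete must therefore end the phase; this identifies
the event found by `phase_ends`. -/
theorem CallStep.not_local_of_complete {n k l : ℕ} {W R F : Type*} {c : Config n k l W R F}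
    {e : Event n k l W R F} {p : Proc n W R} {a a' : Call n l W F} (h : CallStep c e p a a')
    (ha : a.Complete) : e.local? ≠ some p := by
  rcases h with ⟨-, h, -⟩ | ⟨i, hi, -⟩ | ⟨m, -, -, rfl, -⟩
  · exact h
  · simp [ha.1] at hi
  · simp [Event.local?]

namespace Execution

variable {n k l : ℕ} {W R F : Type*} [LinearOrder W] [Field F] {P : System n k l W F}
  {β : Execution R P}

/-! ### Termination of the phases -/

/-- A call that is in progress forever is complete at some time. -/
theorem exists_complete {α : ℝ} (hN : β.N1 α) (hprogress : β.ProcessesProgress)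
    (hlinks : β.ReliableLinks) {T id need : ℕ} {p : Proc n W R} {msg : Fin n → Req l W F}
    (hB : β.Begun T p id need msg) (hneed : need ≤ ⌈α * n⌉₊) (hp : β.NonFaulty p)
    {A : ℕ → Call n l W F} (hA : ∀ τ > T, (β.cfg τ).call? p = some (A τ) ∧ (A τ).id = id)
    (hstep : ∀ τ > T, CallStep (β.cfg τ) (β.ev τ) p (A τ) (A (τ + 1))) :
    ∃ τ > T, (A τ).Complete := by
  have hAneed : ∀ τ > T, (A τ).need = need := by
    intro τ hτ
    obtain ⟨T', -, hB'⟩ := call_begun (hA τ hτ).1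
    rw [(hA τ hτ).2] at hB'
    exact (hB'.unique hB).2.2.1
  have hunsent : ∀ τ > T, ∀ τ' ≥ τ, (A τ').unsent ⊆ (A τ).unsent := by
    intro τ hτ τ' hτ'
    induction τ', hτ' using Nat.le_induction with
    | base => exact subset_rfl
    | succ σ hσ ih =>
      rcases (hstep σ (by omega)).unsent_cases with ⟨h, -⟩ | ⟨i, -, -, h⟩
      · exact h.subset.trans ih
      · exact (h.subset.trans (Finset.erase_subset _ _)).trans ih
  have hsome : ∀ τ > T, ∀ τ' ≥ τ, ∀ i, ((A τ).got i).isSome → ((A τ').got i).isSome := by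
    intro τ hτ τ' hτ' i hi
    induction τ', hτ' using Nat.le_induction with
    | base => exact hi
    | succ σ hσ ih => exact (hstep σ (by omega)).isSome_mono ih
  -- While something is unsent a send is enabled, so the process eventually takes a local step. As
  -- the call persists, that step is a send and the number of unsent messages drops.
  have hsent : ∀ m, ∀ τ > T, (A τ).unsent.card = m → ∃ τ > T, (A τ).unsent = ∅ := by
    intro m
    induction m using Nat.strong_induction_on with
    | _ m ih =>
    intro τ hτ hm
    obtain ⟨σ, hσ, h⟩ := hprogress p τ
    by_cases hne : (A σ).unsent = ∅
    · exact ⟨σ, by omega, hne⟩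
    obtain ⟨i, hi⟩ := Finset.nonempty_iff_ne_empty.2 hne
    have hlocal : (β.ev σ).local? = some p := by
      rcases h with h | h
      · exact h
      · exact (h ⟨_, _, Step.send _ p (A σ) i (hA σ (by omega)).1 hi, rfl⟩).elim
    rcases (hstep σ (by omega)).unsent_cases with ⟨-, h⟩ | ⟨j, hj, -, h⟩
    · exact (h hlocal).elim
    · refine ih _ ?_ (σ + 1) (by omega) rfl
      rw [h, ← hm]
      exact (Finset.card_erase_lt_of_mem hj).trans_le
        (Finset.card_le_card (hunsent τ hτ σ hσ))
  obtain ⟨τ₀, hτ₀, hempty⟩ := hsent _ (T + 1) T.lt_succ_self rfl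
  have hfull : ∃ τ > T, (A τ).count = need := by
    -- If the count never reached `need`, every response from the `N1` set would be accepted on
    -- arrival, giving at least `⌈α n⌉ ≥ need` responses.
    by_contra! hcon
    have hlt : ∀ τ > T, (A τ).count < (A τ).need := fun τ hτ =>
      lt_of_le_of_ne (call_count_le (hA τ hτ).1) (hAneed τ hτ ▸ hcon τ hτ)
    obtain ⟨S, B, hS, -, hans⟩ := hN.answers (hA τ₀ hτ₀).1 ((hA τ₀ hτ₀).2.symm ▸ hB) hempty
    have hgot : ∀ i ∈ S, ∃ τ > T, ((A τ).got i).isSome := by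
      intro i hi
      obtain ⟨σ, h1, -, L, -, -, hm⟩ := hans i hi
      rw [(hA τ₀ hτ₀).2] at hm
      obtain ⟨ρ, hρ, h⟩ := hlinks.2 _ _ hm
      have hρT : ρ > T := by omega
      have hrecv := h.resolve_right (hp ρ)
      refine ⟨ρ + 1, by omega, ?_⟩
      rcases hstep ρ hρT with ⟨-, -, h⟩ | ⟨j, -, h, -⟩ | ⟨m, -, -, h, hacc⟩
      · exact (h _ rfl hrecv).elim
      · simp [hrecv] at h
      · rw [hrecv] at h
        cases h
        rw [hacc, Call.accept, if_pos ⟨(hA ρ hρT).2.symm, hlt ρ hρT⟩]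
        simp
    choose! f hf hfs using hgot
    let N := max (T + 1) (S.sup f)
    have hNT : N > T := lt_max_of_lt_left T.lt_succ_self
    have hcount : S.card ≤ (A N).count := by
      refine Finset.card_le_card fun i hi => Finset.mem_filter.2 ⟨Finset.mem_univ i, ?_⟩
      exact hsome (f i) (hf i hi) N ((Finset.le_sup hi).trans (le_max_right _ _)) i (hfs i hi)
    have := hlt N hNT
    rw [hAneed N hNT] at this
    omega
  obtain ⟨τ₁, hτ₁, hcount⟩ := hfull
  -- Having sent everything and having enough responses both persist.
  refine ⟨max τ₀ τ₁, lt_max_of_lt_left hτ₀,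
    Finset.subset_empty.1 (hempty ▸ hunsent τ₀ hτ₀ _ (le_max_left _ _)), ?_⟩
  refine le_antisymm (call_count_le (hA _ (lt_max_of_lt_left hτ₀)).1) ?_
  rw [hAneed _ (lt_max_of_lt_left hτ₀), ← hcount]
  refine Finset.card_le_card fun i hi => ?_
  simp only [Finset.mem_filter, Finset.mem_univ, true_and] at hi ⊢
  exact hsome τ₁ hτ₁ _ (le_max_right _ _) i hi

/-- A non-faulty process that can go on whenever its call is complete eventually does so. -/
theorem phase_ends {α : ℝ} (hN : β.N1 α) (hprogress : β.ProcessesProgress)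
    (hlinks : β.ReliableLinks) {T id need : ℕ} {p : Proc n W R} {msg : Fin n → Req l W F}
    (hB : β.Begun T p id need msg) (hneed : need ≤ ⌈α * n⌉₊) (hp : β.NonFaulty p)
    (henabled : ∀ τ a, (β.cfg τ).call? p = some a → a.id = id → a.Complete →
      ∃ e c', Step P (β.cfg τ) e c' ∧ e.local? = some p) :
    ∃ τ > T, ∃ a, (β.cfg τ).call? p = some a ∧ a.id = id ∧ a.Complete ∧
      (β.ev τ).local? = some p := by
  by_contra! hcon
  have hnext : ∀ τ > T, ∀ a, (β.cfg τ).call? p = some a → a.id = id →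
      ∃ a', (β.cfg (τ + 1)).call? p = some a' ∧ CallStep (β.cfg τ) (β.ev τ) p a a' := by
    intro τ hτ a ha hid
    rcases (β.step τ).call_forward ha with h | ⟨hl, hc⟩ | h
    · exact h
    · exact (hcon τ hτ a ha hid hc hl).elim
    · exact (hp _ h).elim
  have hcall : ∀ τ > T, ∃ a, (β.cfg τ).call? p = some a ∧ a.id = id := by
    intro τ hτ
    induction τ, Nat.succ_le_of_lt hτ using Nat.le_induction with
    | base => exact ⟨_, hB.2, rfl⟩
    | succ σ hσ ih =>
      obtain ⟨a, ha, hid⟩ := ih hσ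
      obtain ⟨a', ha', hs⟩ := hnext σ hσ a ha hid
      exact ⟨a', ha', hs.id_eq.trans hid⟩
  have : Nonempty (Call n l W F) := ⟨Call.start id need msg⟩
  choose! A hA using hcall
  have hstep : ∀ τ > T, CallStep (β.cfg τ) (β.ev τ) p (A τ) (A (τ + 1)) := by
    intro τ hτ
    obtain ⟨a', ha', hs⟩ := hnext τ hτ _ (hA τ hτ).1 (hA τ hτ).2
    rw [(hA (τ + 1) (by omega)).1] at ha'
    cases ha'
    exact hs
  obtain ⟨τ, hτ, hc⟩ := exists_complete hN hprogress hlinks hB hneed hp hA hstep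
  -- The call stays complete and the next step stays enabled, so progress forces a local step,
  -- against `hcon`.
  have hall : ∀ σ ≥ τ, (A σ).Complete := by
    intro σ hσ
    induction σ, hσ using Nat.le_induction with
    | base => exact hc
    | succ σ hσ ih => exact (hstep σ (by omega)).eq_of_complete ih ▸ ih
  obtain ⟨σ, hσ, h | h⟩ := hprogress p τ
  · exact hcon σ (by omega) _ (hA σ (by omega)).1 (hA σ (by omega)).2 (hall σ hσ) h
  · exact h (henabled σ _ (hA σ (by omega)).1 (hA σ (by omega)).2 (hall σ hσ))

/-! ### Writes -/

/-- In the get-tag phase of a write the writer is in the corresponding state. -/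
theorem writer_getTag_of_call {T τ op : ℕ} {i : W} {v : Value k l F} {a : Call n l W F}
    (he : β.ev T = .invokeWrite i op v) (ha : (β.cfg τ).call? (.writer i) = some a)
    (hid : a.id = op) : (β.cfg τ).writer i = .getTag op v a := by
  have hg : (β.ev T).groupSend? = some (.writer i, op) := by rw [he]; rfl
  simp only [Config.call?] at ha
  cases hs : (β.cfg τ).writer i with
  | getTag op' v' b =>
    rw [hs] at ha
    cases ha
    obtain ⟨hid', T', -, he', hB, -⟩ := writer_getTag_history hs
    rw [← hid', hid] at hB
    obtain rfl := groupSend_time_unique hg hB.1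
    rw [he] at he'
    cases he'
    rfl
  | putData op' t v' b =>
    rw [hs] at ha
    cases ha
    obtain ⟨T', -, he', hB⟩ := writer_putData_history hs
    rw [hid] at hB
    obtain rfl := groupSend_time_unique hg hB.1
    rw [he] at he'
    cases he'
  | _ => simp [hs, WriterState.call?] at ha

/-- In the put-data phase of a write the writer is in the corresponding state. -/
theorem writer_putData_of_call {T τ op id : ℕ} {i : W} {t : Tag W} {a : Call n l W F}
    (he : β.ev T = .writePut i op t id) (ha : (β.cfg τ).call? (.writer i) = some a)
    (hid : a.id = id) : ∃ v, (β.cfg τ).writer i = .putData op t v a := by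
  have hg : (β.ev T).groupSend? = some (.writer i, id) := by rw [he]; rfl
  simp only [Config.call?] at ha
  cases hs : (β.cfg τ).writer i with
  | getTag op' v' b =>
    rw [hs] at ha
    cases ha
    obtain ⟨hid', T', -, he', hB, -⟩ := writer_getTag_history hs
    rw [← hid', hid] at hB
    obtain rfl := groupSend_time_unique hg hB.1
    rw [he] at he'
    cases he'
  | putData op' t v' b =>
    rw [hs] at ha
    cases ha
    obtain ⟨T', -, he', hB⟩ := writer_putData_history hs
    rw [hid] at hB
    obtain rfl := groupSend_time_unique hg hB.1
    rw [he] at he'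
    cases he'
    exact ⟨_, rfl⟩
  | _ => simp [hs, WriterState.call?] at ha

/-- At least `n / 2 + 1 > 0` responses were received, and each answer to a tag query is a tag, so
the maximum is over a nonempty finite set. -/
theorem exists_max_tag {τ op : ℕ} {i : W} {v : Value k l F} {a : Call n l W F}
    (hs : (β.cfg τ).writer i = .getTag op v a) (ha : a.Complete) :
    ∃ t, (∃ s, a.got s = some (.tag t)) ∧ ∀ s t', a.got s = some (.tag t') → t' ≤ t := by
  have hc := Config.call?_writer_getTag hs
  obtain ⟨hid, T, -, -, hB, -⟩ := writer_getTag_history hs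
  rw [← hid] at hB
  obtain ⟨T', -, hB'⟩ := call_begun hc
  have hneed := (hB.unique hB').2.2.1
  have hpos : 0 < a.count := by
    rw [ha.2, ← hneed]
    exact Nat.succ_pos _
  obtain ⟨s, hs⟩ := Finset.card_pos.1 hpos
  obtain ⟨r, hr⟩ := Option.isSome_iff_exists.1 (Finset.mem_filter.1 hs).2
  obtain ⟨σ, -, -, L, -, -, hrL⟩ := got_answered hc hB hr
  have hfin : {t | ∃ s, a.got s = some (.tag t)}.Finite := by
    refine (Set.finite_iUnion (f := fun s => {t | a.got s = some (.tag t)}) fun s =>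
      Set.Subsingleton.finite ?_).subset fun t ⟨s, h⟩ => Set.mem_iUnion.2 ⟨s, h⟩
    intro t ht t' ht'
    have := Eq.trans (Eq.symm ht) ht'
    simpa using this
  obtain ⟨t, ht, hmax⟩ := Set.exists_max_image _ id hfin ⟨maxTag P.t0 L, s, by rw [hr, hrL]; rfl⟩
  exact ⟨t, ht, fun s t' h => hmax t' ⟨s, h⟩⟩

theorem write_completes {α : ℝ} (hN : β.N1 α) (hα : (3 * n + k) ⌈/⌉ 4 ≤ ⌈α * n⌉₊) (hk : 1 ≤ k)
    (hprogress : β.ProcessesProgress) (hlinks : β.ReliableLinks) {i : W} {op τ : ℕ}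
    {v : Value k l F} (he : β.ev τ = .invokeWrite i op v) (hp : β.NonFaulty (.writer i)) :
    ∃ τ' > τ, β.ev τ' = .writeDone i op := by
  have hB : β.Begun τ (.writer i) op (n / 2 + 1) (fun _ => .queryTag) := by
    refine ⟨by rw [he]; rfl, ?_⟩
    have h := β.step τ
    rw [he] at h
    generalize β.cfg (τ + 1) = c' at h ⊢
    cases h with
    | invokeWrite _ _ h =>
      simp only [Config.call?, Config.tick, Config.setWriter, Function.update_self,
        WriterState.call?]
  have hneed : n / 2 + 1 ≤ ⌈α * n⌉₊ := by
    refine le_trans ?_ hα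
    simp only [Nat.ceilDiv_eq_add_pred_div]
    omega
  obtain ⟨τ₁, hτ₁, a, hc, hid, hcomp, hlocal⟩ := phase_ends hN hprogress hlinks hB hneed hp (by
    intro σ a hc hid hcomp
    have hs := writer_getTag_of_call he hc hid
    obtain ⟨t, ht, hmax⟩ := exists_max_tag hs hcomp
    exact ⟨_, _, Step.writePut _ i op v a t hs hcomp ht hmax, rfl⟩)
  have hs := writer_getTag_of_call he hc hid
  obtain ⟨t, hput, hB₁⟩ : ∃ t, β.ev τ₁ = .writePut i op t (β.cfg τ₁).fresh ∧
      β.Begun τ₁ (.writer i) (β.cfg τ₁).fresh ((3 * n + k) ⌈/⌉ 4) (codeElems P t v) := by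
    rcases (β.step τ₁).writer_cases i with ⟨-, h, -⟩ | ⟨f, -, hf⟩ | ⟨v, -, h, -⟩ |
      ⟨op', v', a', s, t', h, hg, -, -, hs'⟩ | ⟨op', t, v, a, -, h, -⟩ | ⟨h, -⟩
    · exact (h hlocal).elim
    · exact ((hf a hc).not_local_of_complete hcomp hlocal).elim
    · simp [hs] at h
    · rw [hs] at hg
      cases hg
      exact ⟨_, h, by rw [h]; rfl, Config.call?_writer_putData hs'⟩
    · simp [hs] at h
    · simp [h, Event.local?] at hlocal
  obtain ⟨τ₂, hτ₂, a₂, hc₂, hid₂, hcomp₂, hlocal₂⟩ :=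
    phase_ends hN hprogress hlinks hB₁ hα hp (by
      intro σ a hc hid hcomp
      obtain ⟨v, hs⟩ := writer_putData_of_call hput hc hid
      exact ⟨_, _, Step.writeDone _ i op t v a hs hcomp, rfl⟩)
  obtain ⟨v₂, hs₂⟩ := writer_putData_of_call hput hc₂ hid₂
  refine ⟨τ₂, by omega, ?_⟩
  rcases (β.step τ₂).writer_cases i with ⟨-, h, -⟩ | ⟨f, -, hf⟩ | ⟨v, -, h, -⟩ |
    ⟨op', v', a', s, t', -, h, -⟩ | ⟨op', t, v, a, h, hg, -⟩ | ⟨h, -⟩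
  · exact (h hlocal₂).elim
  · exact ((hf a₂ hc₂).not_local_of_complete hcomp₂ hlocal₂).elim
  · simp [hs₂] at h
  · simp [hs₂] at h
  · rw [hs₂] at hg
    cases hg
    exact h
  · simp [h, Event.local?] at hlocal₂

/-! ### Reads -/

/-- In the get-data phase of a read the reader is in the corresponding state. -/
theorem reader_getData_of_call {T τ op : ℕ} {r : R} {a : Call n l W F}
    (he : β.ev T = .invokeRead r op) (ha : (β.cfg τ).call? (.reader r) = some a)
    (hid : a.id = op) : (β.cfg τ).reader r = .getData op a := by
  have hg : (β.ev T).groupSend? = some (.reader r, op) := by rw [he]; rfl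
  simp only [Config.call?] at ha
  cases hs : (β.cfg τ).reader r with
  | getData op' b =>
    rw [hs] at ha
    cases ha
    rw [← hid, (reader_getData_history hs).1]
  | putData op' t v' b =>
    rw [hs] at ha
    cases ha
    obtain ⟨T', -, he', hB⟩ := reader_putData_history hs
    rw [hid] at hB
    obtain rfl := groupSend_time_unique hg hB.1
    rw [he] at he'
    cases he'
  | _ => simp [hs, ReaderState.call?] at ha

/-- In the put-data phase of a read the reader is in the corresponding state. -/
theorem reader_putData_of_call {T τ op id : ℕ} {r : R} {t : Tag W} {v : Value k l F}
    {a : Call n l W F} (he : β.ev T = .readPut r op t v id)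
    (ha : (β.cfg τ).call? (.reader r) = some a) (hid : a.id = id) :
    (β.cfg τ).reader r = .putData op t v a := by
  have hg : (β.ev T).groupSend? = some (.reader r, id) := by rw [he]; rfl
  simp only [Config.call?] at ha
  cases hs : (β.cfg τ).reader r with
  | getData op' b =>
    rw [hs] at ha
    cases ha
    obtain ⟨hid', T', -, he', hB, -⟩ := reader_getData_history hs
    rw [← hid', hid] at hB
    obtain rfl := groupSend_time_unique hg hB.1
    rw [he] at he'
    cases he'
  | putData op' t v' b =>
    rw [hs] at ha
    cases ha
    obtain ⟨T', -, he', hB⟩ := reader_putData_history hs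
    rw [hid] at hB
    obtain rfl := groupSend_time_unique hg hB.1
    rw [he] at he'
    cases he'
    rfl
  | _ => simp [hs, ReaderState.call?] at ha

/-- For `k ≥ 1` a decodable tag occurs in one of finitely many finite lists; for `k = 0` every tag
would be decodable. -/
theorem exists_max_decodable (hk : 1 ≤ k) {G : Matrix (Fin n) (Fin k) F}
    {got : Fin n → Option (Resp l W F)} (h : ∃ t v, Decodable (k := k) G got t v) :
    ∃ t v, Decodable G got t v ∧ ∀ t' v', Decodable G got t' v' → t' ≤ t := by
  have hfin : {t | ∃ v, Decodable G got t v}.Finite := by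
    refine (Set.finite_iUnion
      (f := fun s => {t | ∃ L x, got s = some (Resp.list L) ∧ (t, x) ∈ L}) fun s => ?_).subset ?_
    · by_cases hL : ∃ L, got s = some (.list L)
      · obtain ⟨L, hL⟩ := hL
        refine (L.image Prod.fst).finite_toSet.subset ?_
        rintro t ⟨L', x, h, hx⟩
        rw [hL] at h
        cases h
        exact Finset.mem_coe.2 (Finset.mem_image.2 ⟨_, hx, rfl⟩)
      · refine Set.finite_empty.subset ?_
        rintro t ⟨L, x, h, -⟩
        exact hL ⟨L, h⟩
    · rintro t ⟨v, S, hS, hmem⟩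
      obtain ⟨i, hi⟩ : S.Nonempty := Finset.card_pos.1 (by omega)
      obtain ⟨L, hL, hx⟩ := hmem i hi
      exact Set.mem_iUnion.2 ⟨i, L, _, hL, hx⟩
  obtain ⟨t, ⟨v, hv⟩, hmax⟩ := Set.exists_max_image _ id hfin h
  exact ⟨t, v, hv, fun t' v' h => hmax t' ⟨v', h⟩⟩

theorem read_completes {α : ℝ} (hN : β.N1 α) (hα : (3 * n + k) ⌈/⌉ 4 ≤ ⌈α * n⌉₊) (hk : 1 ≤ k)
    (hkn : k ≤ n) (hδ : β.ConcurrencyAtMost P.delta) (hprogress : β.ProcessesProgress)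
    (hlinks : β.ReliableLinks) {r : R} {op τ : ℕ} (he : β.ev τ = .invokeRead r op)
    (hp : β.NonFaulty (.reader r)) : ∃ τ' > τ, ∃ v, β.ev τ' = .readDone r op v := by
  have hB : β.Begun τ (.reader r) op ((n + k) ⌈/⌉ 2) (fun _ => .queryList) := by
    refine ⟨by rw [he]; rfl, ?_⟩
    have h := β.step τ
    rw [he] at h
    generalize β.cfg (τ + 1) = c' at h ⊢
    cases h with
    | invokeRead _ h =>
      simp only [Config.call?, Config.tick, Config.setReader, Function.update_self,
        ReaderState.call?]
  -- `(n+k)/2 ≤ (3n+k)/4` amounts to `k ≤ n`.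
  have hneed : (n + k) ⌈/⌉ 2 ≤ ⌈α * n⌉₊ := by
    refine le_trans ?_ hα
    simp only [Nat.ceilDiv_eq_add_pred_div]
    omega
  obtain ⟨τ₁, hτ₁, a, hc, hid, hcomp, hlocal⟩ := phase_ends hN hprogress hlinks hB hneed hp (by
    intro σ a hc hid hcomp
    have hs := reader_getData_of_call he hc hid
    -- Here the read could be stuck; decodability of the received lists rules this out.
    obtain ⟨t, v, hdec, hmax⟩ := exists_max_decodable hk
      (HasLists.decodable hN hα hk hδ ⟨hs, hcomp.2⟩)
    exact ⟨_, _, Step.readPut _ r op a t v hs hcomp hdec hmax, rfl⟩)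
  have hs := reader_getData_of_call he hc hid
  obtain ⟨t, v, hput, hB₁⟩ : ∃ t v, β.ev τ₁ = .readPut r op t v (β.cfg τ₁).fresh ∧
      β.Begun τ₁ (.reader r) (β.cfg τ₁).fresh ((3 * n + k) ⌈/⌉ 4) (codeElems P t v) := by
    rcases (β.step τ₁).reader_cases r with ⟨-, h, -⟩ | ⟨f, -, hf⟩ | ⟨-, h, -⟩ |
      ⟨op', a', t, v, h, hg, -, -, hs'⟩ | ⟨op', t, v, a, -, h, -⟩ | ⟨h, -⟩
    · exact (h hlocal).elim
    · exact ((hf a hc).not_local_of_complete hcomp hlocal).elim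
    · simp [hs] at h
    · rw [hs] at hg
      cases hg
      exact ⟨t, v, h, by rw [h]; rfl, Config.call?_reader_putData hs'⟩
    · simp [hs] at h
    · simp [h, Event.local?] at hlocal
  obtain ⟨τ₂, hτ₂, a₂, hc₂, hid₂, hcomp₂, hlocal₂⟩ :=
    phase_ends hN hprogress hlinks hB₁ hα hp (by
      intro σ a hc hid hcomp
      exact ⟨_, _, Step.readDone _ r op t v a (reader_putData_of_call hput hc hid) hcomp, rfl⟩)
  have hs₂ := reader_putData_of_call hput hc₂ hid₂
  refine ⟨τ₂, by omega, v, ?_⟩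
  rcases (β.step τ₂).reader_cases r with ⟨-, h, -⟩ | ⟨f, -, hf⟩ | ⟨-, h, -⟩ |
    ⟨op', a', t, v, -, h, -⟩ | ⟨op', t, v, a, h, hg, -⟩ | ⟨h, -⟩
  · exact (h hlocal₂).elim
  · exact ((hf a₂ hc₂).not_local_of_complete hcomp₂ hlocal₂).elim
  · simp [hs₂] at h
  · simp [hs₂] at h
  · rw [hs₂] at hg
    cases hg
    exact h
  · simp [h, Event.local?] at hlocal₂

end Execution

/-- Turns the real bound on `α` into the only form in which it is used: the `N1` set is at least as
large as the put-data quorum. -/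
theorem ceilDiv_le_ceil_mul {n k : ℕ} (hn : 0 < n) {α : ℝ}
    (hα : (3 * n + k : ℝ) / (4 * n) ≤ α) : (3 * n + k) ⌈/⌉ 4 ≤ ⌈α * n⌉₊ := by
  have hn' : (0 : ℝ) < n := by exact_mod_cast hn
  rw [div_le_iff₀ (by positivity)] at hα
  have h := Nat.le_ceil (α * n)
  have h' : ((3 * n + k : ℕ) : ℝ) ≤ ((4 * ⌈α * n⌉₊ : ℕ) : ℝ) := by
    push_cast
    linarith
  have := Nat.cast_le.1 h'
  simp only [Nat.ceilDiv_eq_add_pred_div]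
  omega

end

end Radon

theorem theorem4 {n k l : ℕ} {W R F : Type*} [LinearOrder W] [Field F] [Finite F]
    (hk : 1 ≤ k) (hkn : k ≤ n)
    (P : Radon.System n k l W F) (hP : Radon.IsMDS P.gen)
    (α : ℝ) (hα0 : 0 < α) (hα1 : α < 1) (hα : (3 * n + k : ℝ) / (4 * n) ≤ α)
    (β : Radon.Execution R P)
    (hprogress : β.ProcessesProgress) (hlinks : β.ReliableLinks)
    (hN1 : β.N1 α) (hδ : β.ConcurrencyAtMost P.delta) :
    -- every write operation invoked by a non-faulty writer completes
    (∀ (i : W) (op : ℕ) (v : Radon.Value k l F) (τ : ℕ),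
      β.ev τ = .invokeWrite i op v → β.NonFaulty (.writer i) →
        ∃ τ' > τ, β.ev τ' = .writeDone i op) ∧
    -- every read operation invoked by a non-faulty reader completes
    (∀ (r : R) (op : ℕ) (τ : ℕ),
      β.ev τ = .invokeRead r op → β.NonFaulty (.reader r) →
        ∃ τ' > τ, ∃ v, β.ev τ' = .readDone r op v) ∧
    -- whenever a read operation has received its lists, `k` of them share a decodable tag
    (∀ (r : R) (op : ℕ) (a : Radon.Call n l W F) (T : ℕ),
      β.HasLists r op a T → ∃ t v, Radon.Decodable P.gen a.got t v) := by
  have hα' := Radon.ceilDiv_le_ceil_mul (by omega) hα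
  exact ⟨fun i op v τ he hp =>
      Radon.Execution.write_completes hN1 hα' hk hprogress hlinks he hp,
    fun r op τ he hp =>
      Radon.Execution.read_completes hN1 hα' hk hkn hδ hprogress hlinks he hp,
    fun r op a T h => Radon.Execution.HasLists.decodable hN1 hα' hk hδ h⟩
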